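/- Consider full-pay (9/6) Jacks or Better video poker. The player bets one unit and is dealt a five-card hand, uniformly distributed over the $\binom{52}{5}$ hands from a standard deck. He holds any subset of it, of size $k$ say ($0\le k\le 5$), and then draws $5-k$ new cards, uniformly distributed over the $\binom{47}{5-k}$ possibilities from the 47 cards not in the initial hand. The return per unit bet $R_1$ is determined by the final hand: 800 for a royal flush, 50 for a straight flush, 25 for four of a kind, 9 for a full house, 6 for a flush, 4 for a straight (in which an ace may be high or low), 3 for three of a kind, 2 for two pairs, 1 for a pair of jacks or better, and 0 otherwise. A strategy assigns to each initial hand the set of cards to be held; it is optimal if it maximizes $\mathrm{E}[R_1]$ over all strategies. In the $n$-play game with a given strategy, the draw to the same held cards is carried out $n$ times, conditionally independently given the initial hand, with returns $R_1,\dots,R_n$, and the return per unit bet is $(R_1+\cdots+R_n)/n$. Let $X$ be the equivalence class of the initial hand, two hands being equivalent if one is obtained from the other by a permutation of the four suits, and put $V_{\rm deal}=\mathrm{Var}(\mathrm{E}[R_1\mid X])$ and $V_{\rm draw}=\mathrm{E}[\mathrm{Var}(R_1\mid X)]$. An optimal strategy exists, and under every optimal strategy, $\mathrm{Var}(R_1)=V_{\rm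 deal}+V_{\rm draw}$ and $$\mathrm{E}[R_1]=\frac{1653526326983}{1661102543100}\approx 0.995439,\qquad \mathrm{Var}(R_1)=\frac{53846098447064372932173011}{2759261658693287357610000}\approx 19.514676,$$ $$V_{\rm deal}=\frac{602864541441854523450139}{306584628743698595290000}\approx 1.966389,\qquad V_{\rm draw}=\frac{55891953982463387918}{3185037467325338625}\approx 17.548288.$$ For every $n\ge1$, the return per unit bet of the $n$-play game has mean $\mathrm{E}[R_1]$ and variance $V_{\rm deal}+\frac1n V_{\rm draw}$. In particular its mean, variance and standard deviation are as follows. $$\begin{array}{rccc} n & \text{mean} & \text{variance} & \text{standard deviation}\\ 1&0.995439&19.514676&4.417542\\ 3&0.995439&7.815818&2.795678\\ 5&0.995439&5.476046&2.340095\\ 10&0.995439&3.721217&1.929046\\ 25&0.995439&2.668320&1.633499\\ 50&0.995439&2.317354&1.522286\\ 100&0.995439&2.141872&1.463513 \end{array}$$ All decimal values are rounded to six decimal places. -/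

import Mathlib

open MeasureTheory ProbabilityTheory

namespace VideoPoker

/-- A card is a denomination together with a suit. Denominations are coded in increasing order,
`0` being the deuce, `8` the ten, `9` the jack, `10` the queen, `11` the king, `12` the ace. -/
abbrev Card : Type := Fin 13 × Fin 4

instance instMeasurableSpaceFinsetCard : MeasurableSpace (Finset Card) := ⊤

instance instDiscreteMeasurableSpaceFinsetCard : DiscreteMeasurableSpace (Finset Card) :=
  ⟨fun _ => trivial⟩

/-- A (five-card) hand dealt from the 52-card deck. -/
abbrev Hand : Type := {h : Finset Card // h.card = 5}

/-! ### Pay table -/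

/-- The set of denominations that occur in `h`. -/
def ranks (h : Finset Card) : Finset (Fin 13) := h.image Prod.fst

/-- The number of cards of denomination `r` in `h`. -/
def rankCount (h : Finset Card) (r : Fin 13) : ℕ := (h.filter fun c => c.1 = r).card

/-- All cards are of the same suit. -/
abbrev IsFlush (h : Finset Card) : Prop := ∃ s : Fin 4, ∀ c ∈ h, c.2 = s

/-- Five consecutive denominations; the ace can also be low, as in A-2-3-4-5. -/
abbrev IsStraight (h : Finset Card) : Prop :=
  ranks h = {12, 0, 1, 2, 3} ∨
    ∃ k ∈ Finset.range 9, (ranks h).image (fun r => r.val) = Finset.Icc k (k + 4)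

/-- The return, per unit bet (assuming a maximum bet), of a final five-card hand in full-pay
(9/6) Jacks or Better. -/
def payout (h : Finset Card) : ℕ :=
  if IsFlush h ∧ ranks h = {8, 9, 10, 11, 12} then 800                     -- royal flush
  else if IsFlush h ∧ IsStraight h then 50                                 -- straight flush
  else if ∃ r, rankCount h r = 4 then 25                                   -- four of a kind
  else if (∃ r, rankCount h r = 3) ∧ (∃ r, rankCount h r = 2) then 9       -- full house
  else if IsFlush h then 6                                                 -- flush
  else if IsStraight h then 4                                              -- straight
  else if ∃ r, rankCount h r = 3 then 3                                    -- three of a kind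
  else if (Finset.univ.filter fun r => rankCount h r = 2).card = 2 then 2  -- two pairs
  else if ∃ r, 9 ≤ r ∧ rankCount h r = 2 then 1                            -- jacks or better
  else 0

/-! ### Strategies and the `n`-play game -/

/-- A strategy specifies, for each initial hand, which of its cards are held. -/
structure Strategy where
  hold : Hand → Finset Card
  hold_subset : ∀ h, hold h ⊆ h.1

/-- The law of the initial hand: all `52.choose 5` hands are equally likely. -/
noncomputable def dealLaw : Measure Hand := uniformOn Set.univ

/-- The law of the cards drawn when the cards `s` of the initial hand `h` are held: a uniformly
distributed set of `5 - s.card` of the 47 cards not in `h`. -/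
noncomputable def drawLaw (h : Hand) (s : Finset Card) : Measure (Finset Card) :=
  uniformOn {d | Disjoint d h.1 ∧ d.card = 5 - s.card}

/-- Given the initial hand, the `n` draws are independent, each with law `drawLaw`. -/
noncomputable def drawsKernel (σ : Strategy) (n : ℕ) : Kernel Hand (Fin n → Finset Card) :=
  Kernel.ofFunOfCountable fun h => Measure.pi fun _ : Fin n => drawLaw h (σ.hold h)

/-- The law of the `n`-play game under the strategy `σ`. An outcome consists of the initial hand
and of the cards drawn in each of the `n` plays. -/
noncomputable def gameLaw (σ : Strategy) (n : ℕ) : Measure (Hand × (Fin n → Finset Card)) :=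
  dealLaw ⊗ₘ drawsKernel σ n

/-- The return of play `i`, per unit bet on that play. -/
def playReturn (σ : Strategy) {n : ℕ} (i : Fin n) (ω : Hand × (Fin n → Finset Card)) : ℝ :=
  payout (σ.hold ω.1 ∪ ω.2 i)

/-- The return `(R₁ + ⋯ + Rₙ) / n`, per unit bet, of the `n`-play game. -/
noncomputable def averageReturn (σ : Strategy) (n : ℕ) (ω : Hand × (Fin n → Finset Card)) : ℝ :=
  (∑ i, playReturn σ i ω) / n

/-! ### The single-play game -/

/-- The sample space of the single-play game. -/
abbrev Single : Type := Hand × (Fin 1 → Finset Card)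

/-- The return `R₁` of the single-play game, per unit bet. -/
def R₁ (σ : Strategy) : Single → ℝ := playReturn σ 0

/-- The mean `E[R₁]`. -/
noncomputable def meanReturn (σ : Strategy) : ℝ := ∫ ω, R₁ σ ω ∂(gameLaw σ 1)

/-- A strategy is optimal if it maximizes the mean return. -/
def IsOptimal (σ : Strategy) : Prop := ∀ τ : Strategy, meanReturn τ ≤ meanReturn σ

/-- Two initial hands are equivalent if one is obtained from the other by a permutation of the
four suits. -/
def HandEquiv (h h' : Hand) : Prop :=
  ∃ g : Equiv.Perm (Fin 4), h'.1 = h.1.image fun c => (c.1, g c.2)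

/-- The equivalence class to which a hand belongs. -/
def handClass (h : Hand) : Set Hand := {h' | HandEquiv h h'}

/-- The σ-algebra generated by the equivalence class `X` of the initial hand. -/
abbrev dealSigma : MeasurableSpace Single :=
  MeasurableSpace.comap (fun ω => handClass ω.1) ⊤

/-- `Var(R₁)`. -/
noncomputable def varReturn (σ : Strategy) : ℝ := Var[R₁ σ; gameLaw σ 1]

/-- The variance explained by the deal, `Var(E[R₁ | X])`. -/
noncomputable def vDeal (σ : Strategy) : ℝ :=
  Var[(gameLaw σ 1)[R₁ σ | dealSigma]; gameLaw σ 1]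

/-- The variance explained by the draw, `E[Var(R₁ | X)]`. -/
noncomputable def vDraw (σ : Strategy) : ℝ :=
  ∫ ω, (Var[R₁ σ; gameLaw σ 1 | dealSigma]) ω ∂(gameLaw σ 1)

/-- `a` is the value of `x` rounded to six decimal places. -/
def RoundsTo (x a : ℝ) : Prop := |x - a| < 1 / (2 * 10 ^ 6)

end VideoPoker

/-! An optimal strategy maximizes the conditional mean return separately for every initial hand
(`isOptimal_iff`), so everything reduces to finite sums over the hands. Means are multiplied by
7669695, the least common multiple of the numbers of possible draws. With `maxValue payout h` the
scaled maximum at `h`, the mean and `V_deal` follow from `sum_maxValue` and `sum_maxValue_sq`.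

The second moment could depend on how ties between optimal holds are broken. To exclude this, the
payout `p` is replaced by the weights `p * 2 ^ 43 + p ^ 2` and `p * 2 ^ 43 - p ^ 2`. Scaled second
moments stay below `2 ^ 43`, so maximizing either weight maximizes the mean first; among ties the
one then maximizes the second moment and the other minimizes it. The two totals leave a single
possible value for the sum of second moments (`sum_value_sq`), whichever optimal strategy is used.

The totals are evaluated by the kernel. Hands are grouped by the multiplicities of their
denominations and by their suit pattern up to permutations of the suits (`sum_hands`). For one
pattern, all choices of denominations are treated simultaneously: their values occupy 96-bit lanes
of one natural number, on which sums, differences, maxima and squares act lane by lane. The value of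
holding `s` and discarding `D` needs the total weight of the final hands that contain `s` and avoid
`D`. By `containSum_insert` it is a difference of totals with fewer discards, so totals with no
discards suffice. These depend only on the denominations held, apart from a correction for flushes
(`containSum_handWeight`), and are tabulated by the recursion `mul_containSum`. `total_eq` connects
the computation with the sums over hands.

On the probabilistic side, the draws are independent and identically distributed given the hand, so
the law of total variance gives the dependence on `n` (`variance_averageReturn`). The class `X` is
coarser than the hand, but under an optimal strategy the conditional mean is a maximum invariant
under permutations of the suits; thus conditioning on `X` or on the hand gives the same mean
(`condExp_eq`). -/

namespace VideoPoker

/-! ### Functions evaluated by the kernel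

They are written with recursors and with primitive operations on natural numbers, and lists are
passed to continuations in normal form, so that the kernel evaluates them quickly. -/

section Kernel

variable {α β : Type}

/-- `if b then x else y` -/
noncomputable def sel (b : Bool) (x y : α) : α := @Bool.rec (fun _ => α) y x b

/-- Recursion on lists. -/
noncomputable def lrec (z : β) (f : α → List α → β → β) (l : List α) : β :=
  @List.rec α (fun _ => β) z f l

/-- The sum of `f k` over `k < n`. -/
noncomputable def nsum (n : ℕ) (f : ℕ → ℕ) : ℕ :=
  @Nat.rec (fun _ => ℕ) 0 (fun k ih => Nat.add ih (f k)) n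

/-- The sum of `f x` over the entries `x` of `l`. -/
noncomputable def lsum (l : List α) (f : α → ℕ) : ℕ :=
  lrec 0 (fun x _ ih => Nat.add (f x) ih) l

/-- The weight of a payout: `p * 2 ^ 43 + p ^ 2` or `p * 2 ^ 43 - p ^ 2`. -/
noncomputable def weight (plus : Bool) (p : ℕ) : ℕ :=
  sel plus (Nat.add (Nat.mul p 8796093022208) (Nat.mul p p))
    (Nat.sub (Nat.mul p 8796093022208) (Nat.mul p p))

/-- The payout, disregarding flushes, of a hand with denominations `a ≤ b ≤ c ≤ d ≤ e`. -/
noncomputable def rankPay (a b c d e : ℕ) : ℕ :=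
  sel (Nat.beq a b)
    (sel (Nat.beq b c)
      (sel (Nat.beq c d) 25 (sel (Nat.beq d e) 9 3))
      (sel (Nat.beq c d) (sel (Nat.beq d e) 9 2) (sel (Nat.beq d e) 2 (sel (Nat.ble 9 a) 1 0))))
    (sel (Nat.beq b c)
      (sel (Nat.beq c d) (sel (Nat.beq d e) 25 3) (sel (Nat.beq d e) 2 (sel (Nat.ble 9 b) 1 0)))
      (sel (Nat.beq c d) (sel (Nat.beq d e) 3 (sel (Nat.ble 9 c) 1 0))
        (sel (Nat.beq d e) (sel (Nat.ble 9 d) 1 0)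
          (sel (Nat.beq e (Nat.add a 4)) 4 (sel (Nat.beq e 12) (sel (Nat.beq d 3) 4 0) 0)))))

/-- The payout of a flush with denominations `a < b < c < d < e`. -/
noncomputable def flushPay (a d e : ℕ) : ℕ :=
  sel (Nat.beq e (Nat.add a 4)) (sel (Nat.beq a 8) 800 50)
    (sel (Nat.beq e 12) (sel (Nat.beq d 3) 50 6) 6)

/-- The value of `f` at the entries of a list of length five. -/
noncomputable def onFive (f : ℕ → ℕ → ℕ → ℕ → ℕ → ℕ) (l : List ℕ) : ℕ :=
  lrec 0 (fun a l _ => lrec 0 (fun b l _ => lrec 0 (fun c l _ => lrec 0 (fun d l _ =>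
    lrec 0 (fun e _ _ => f a b c d e) l) l) l) l) l

noncomputable def rankWeight (plus : Bool) : List ℕ → ℕ :=
  onFive fun a b c d e => weight plus (rankPay a b c d e)

/-- What is added to the weight if the hand is a flush. -/
noncomputable def flushBonus (plus : Bool) : List ℕ → ℕ :=
  onFive fun a b c d e => Nat.sub (weight plus (flushPay a d e)) (weight plus (rankPay a b c d e))

/-- The number of entries equal to `r` at the beginning of `v`. -/
noncomputable def leading (r : ℕ) (v : List ℕ) : ℕ :=
  lrec 0 (fun x _ ih => sel (Nat.beq r x) (Nat.succ ih) 0) v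

/-- `k (v.count r) w`, where `w` results from the sorted list `v` by insertion of `r`. -/
noncomputable def insertK (r : ℕ) (v : List ℕ) : (ℕ → List ℕ → ℕ) → ℕ :=
  @List.rec ℕ (fun _ => (ℕ → List ℕ → ℕ) → ℕ) (fun k => k 0 [r])
    (fun x t ih k => sel (Nat.ble r x) (k (leading r (x :: t)) (r :: x :: t))
      (ih fun n w => k n (x :: w))) v

/-- The sum of `base w` over all hands containing `5 - k` given cards with denominations `v`, if
there are `q` cards of each denomination. -/
noncomputable def table (q : ℕ) (base : List ℕ → ℕ) (k : ℕ) : List ℕ → ℕ :=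
  @Nat.rec (fun _ => List ℕ → ℕ) base
    (fun k ih v => Nat.div
      (nsum 13 fun r => insertK r v fun n w =>
        @Nat.rec (fun _ => ℕ) 0 (fun c _ => Nat.mul (Nat.succ c) (ih w)) (Nat.sub q n))
      (Nat.succ k)) k

noncomputable def len (v : List α) : ℕ := lrec 0 (fun _ _ ih => Nat.succ ih) v

noncomputable def rankTable (plus : Bool) (v : List ℕ) : ℕ :=
  table 4 (rankWeight plus) (Nat.sub 5 (len v)) v

noncomputable def flushTable (plus : Bool) (v : List ℕ) : ℕ :=
  table 1 (flushBonus plus) (Nat.sub 5 (len v)) v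

/-- The binomial coefficient. -/
noncomputable def binom (n : ℕ) : ℕ → ℕ :=
  @Nat.rec (fun _ => ℕ → ℕ) (fun k => @Nat.rec (fun _ => ℕ) 1 (fun _ _ => 0) k)
    (fun _ ih k => @Nat.rec (fun _ => ℕ) 1 (fun k' _ => Nat.add (ih k') (ih (Nat.succ k'))) k) n

/-- `k w`, where `w` is `v` preceded by `c` copies of `x`. -/
noncomputable def consK (c x : ℕ) : List ℕ → (List ℕ → ℕ) → ℕ :=
  @Nat.rec (fun _ => List ℕ → (List ℕ → ℕ) → ℕ) (fun v k => k v) (fun _ ih v k => ih (x :: v) k) c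

/-- The values of `T`, packed in one number, at the lists consisting of `c` copies of `r`, where
`c` runs through `cs` and `r` through a decreasing sequence of numbers less than `n`. -/
noncomputable def gather (T : List ℕ → ℕ) (n : ℕ) : List ℕ → List ℕ → ℕ :=
  @Nat.rec (fun _ => List ℕ → List ℕ → ℕ) (fun cs v => lrec (T v) (fun _ _ _ => 0) cs)
    (fun n ih cs v => lrec (T v) (fun c cs _ =>
      Nat.add (consK c n v (ih cs))
        (Nat.shiftLeft (ih (c :: cs) v) (Nat.mul 96 (binom n (len cs))))) cs) n

/-- The number with `m` lanes equal to one. -/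
noncomputable def ones (m : ℕ) : ℕ :=
  Nat.div (Nat.sub (Nat.shiftLeft 1 (Nat.mul 96 m)) 1) 79228162514264337593543950335

/-- The lane-wise maximum. -/
noncomputable def vmax (m a b : ℕ) : ℕ :=
  (fun d => (fun g => Nat.add b (Nat.land d (Nat.sub g (Nat.shiftRight g 95))))
      (Nat.land d (Nat.shiftLeft (ones m) 95)))
    (Nat.sub (Nat.add a (Nat.shiftLeft (ones m) 95)) b)

/-- `7669695 / Nat.choose 47 (5 - k)` -/
noncomputable def scale (k : ℕ) : ℕ :=
  lrec 0 (fun a _ _ => a) (@Nat.rec (fun _ => List ℕ) [5, 43, 473, 7095, 163185, 7669695]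
    (fun _ ih => lrec [] (fun _ l _ => l) ih) k)

/-- `k cs'`, where `cs'` results from `cs` by increasing the entry with index `i` by one. -/
noncomputable def incK (i : ℕ) : List ℕ → (List ℕ → ℕ) → ℕ :=
  @Nat.rec (fun _ => List ℕ → (List ℕ → ℕ) → ℕ)
    (fun cs k => lrec 0 (fun c cs _ => k (Nat.succ c :: cs)) cs)
    (fun _ ih cs k => lrec 0 (fun c cs _ => ih cs fun cs' => k (c :: cs')) cs) i

/-- `k cs`, where `cs` is the list of length `j` whose entry with index `i` is the number of
entries of `l` with first component `i`. -/
noncomputable def countsK (j : ℕ) (l : List (ℕ × ℕ)) : (List ℕ → ℕ) → ℕ :=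
  @List.rec (ℕ × ℕ) (fun _ => (List ℕ → ℕ) → ℕ) (consK j 0 [])
    (fun p _ ih k => ih fun cs => incK p.1 cs k) l

/-- The common second component of the entries of `l`; it is `4` if `l` is empty and `5` if there
is no common one. -/
noncomputable def commonSuit (l : List (ℕ × ℕ)) : ℕ :=
  lrec 4 (fun p _ ih => sel (Nat.beq ih 4) p.2 (sel (Nat.beq ih p.2) ih 5)) l

/-- The total weight of the hands that contain certain cards, for all choices of denominations. -/
noncomputable def containing (plus : Bool) (j : ℕ) (l : List (ℕ × ℕ)) : ℕ :=
  countsK j l fun cs =>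
    Nat.add (gather (rankTable plus) 13 cs [])
      ((fun q => sel (Nat.beq q 5) 0
        (Nat.mul (sel (Nat.beq q 4) 4 1) (gather (flushTable plus) 13 cs []))) (commonSuit l))

/-- The lane-wise maximum over all ways to hold or discard the cards in a list. -/
noncomputable def best (m : ℕ) (l : List (ℕ × ℕ)) : (List (ℕ × ℕ) → ℕ) → ℕ → ℕ :=
  @List.rec (ℕ × ℕ) (fun _ => (List (ℕ × ℕ) → ℕ) → ℕ → ℕ) (fun G k => Nat.mul (scale k) (G []))
    (fun p _ ih G k => vmax m (ih (fun t => G (p :: t)) (Nat.succ k))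
      (ih (fun t => Nat.sub (G t) (G (p :: t))) k)) l

/-- The maximal values, packed in one number, of all initial hands of a given pattern. -/
noncomputable def values (plus : Bool) (j : ℕ) (l : List (ℕ × ℕ)) : ℕ :=
  best (binom 13 j) l (containing plus j) 0

/-- The lanes divided by `2 ^ 43`. -/
noncomputable def high (m a : ℕ) : ℕ :=
  Nat.shiftRight (Nat.land a (Nat.mul 79228162514264328797450928128 (ones m))) 43

/-- The squares of the lanes. -/
noncomputable def squares (m a : ℕ) : ℕ :=
  nsum 33 fun i => Nat.shiftLeft (Nat.land (Nat.mul (Nat.shiftRight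
    (Nat.land a (Nat.mul (Nat.pow 2 i) (ones m))) i) 8589934591) a) i

/-- The sum of the lanes. -/
noncomputable def laneSum (m : ℕ) : ℕ → ℕ :=
  @Nat.rec (fun _ => ℕ → ℕ) (fun _ => 0)
    (fun _ ih x => Nat.add (Nat.mod x 79228162514264337593543950336) (ih (Nat.shiftRight x 96))) m

end Kernel

/-! ### Suit patterns, compositions and the numerical totals -/

/-- Representatives of the `m`-element sets of suits up to permutations that fix the suits less
than `k`; an entry consists of the number of sets represented, of a representative, and of a number
`k' ≥ k` such that the suits in the representative are less than `k'`. -/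
def suitSteps : ℕ → ℕ → List (ℕ × List ℕ × ℕ)
  | 0, 1 => [(4, [0], 1)]
  | 0, 2 => [(6, [0, 1], 2)]
  | 0, 3 => [(4, [0, 1, 2], 3)]
  | 0, 4 => [(1, [0, 1, 2, 3], 4)]
  | 1, 1 => [(1, [0], 1), (3, [1], 2)]
  | 1, 2 => [(3, [0, 1], 2), (3, [1, 2], 3)]
  | 1, 3 => [(3, [0, 1, 2], 3), (1, [1, 2, 3], 4)]
  | 1, 4 => [(1, [0, 1, 2, 3], 4)]
  | 2, 1 => [(1, [0], 2), (1, [1], 2), (2, [2], 3)]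
  | 2, 2 => [(1, [0, 1], 2), (2, [0, 2], 3), (2, [1, 2], 3), (1, [2, 3], 4)]
  | 2, 3 => [(2, [0, 1, 2], 3), (1, [0, 2, 3], 4), (1, [1, 2, 3], 4)]
  | 2, 4 => [(1, [0, 1, 2, 3], 4)]
  | _, 1 => [(1, [0], 4), (1, [1], 4), (1, [2], 4), (1, [3], 4)]
  | _, 2 => [(1, [0, 1], 4), (1, [0, 2], 4), (1, [0, 3], 4), (1, [1, 2], 4), (1, [1, 3], 4),
      (1, [2, 3], 4)]
  | _, 3 => [(1, [0, 1, 2], 4), (1, [0, 1, 3], 4), (1, [0, 2, 3], 4), (1, [1, 2, 3], 4)]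
  | _, 4 => [(1, [0, 1, 2, 3], 4)]
  | _, _ => []

/-- Representatives, with multiplicities, of the choices of sets of suits with sizes `κ`, up to
permutations of the suits. A choice is coded by the list of pairs (index of the set, suit). -/
def suitClasses : List ℕ → ℕ → ℕ → List (ℕ × List (ℕ × ℕ))
  | [], _, _ => [(1, [])]
  | m :: κ, i, k => (suitSteps k m).flatMap fun s =>
      (suitClasses κ (i + 1) s.2.2).map fun p => (s.1 * p.1, s.2.1.map (fun q => (i, q)) ++ p.2)

/-- The compositions of `n` with parts at most four, provided that `n ≤ f`. -/
def compositions : ℕ → ℕ → List (List ℕ)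
  | _, 0 => [[]]
  | 0, _ + 1 => []
  | f + 1, n + 1 => [1, 2, 3, 4].flatMap fun m =>
      if m ≤ n + 1 then (compositions f (n + 1 - m)).map (m :: ·) else []

noncomputable def total (post : ℕ → ℕ → ℕ) (plus : Bool) : ℕ :=
  lsum (compositions 5 5) fun κ => laneSum (binom 13 (len κ))
    (lsum (suitClasses κ 0 0) fun p => Nat.mul p.1
      (post (binom 13 (len κ)) (values plus (len κ) p.2)))

/-- Sums over all hands of, in turn, the maximal weight, its quotient by `2 ^ 43` (the maximal
scaled mean), and the square of that quotient. -/
theorem total_plus :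
    (total (fun _ a => a) true, total high true, total (fun m a => squares m (high m a)) true) =
      (174534856642157423423339124, 19842315923796, 452115441148910245356) := by
  decide +kernel

/-- The counterpart that penalizes second moments. This total and the first one in `total_plus` are
equally far, namely 408742359677556, from `2 ^ 43` times the sum of the maximal scaled means; hence
ties do not matter. -/
theorem total_minus :
    total (fun _ a => a) false = 174534856641339938703984012 := by
  decide +kernel

/-! ### Evaluation of the kernel functions -/

section Eval

variable {α β ι : Type}

theorem sel_eq (b : Bool) (x y : α) : sel b x y = if b then x else y := by cases b <;> rfl

theorem nsum_eq (n : ℕ) (f : ℕ → ℕ) : nsum n f = ∑ k ∈ Finset.range n, f k := by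
  induction n with
  | zero => rfl
  | succ n ih => rw [Finset.sum_range_succ, ← ih]; rfl

theorem lsum_eq (l : List α) (f : α → ℕ) : lsum l f = (l.map f).sum := by
  induction l with
  | nil => rfl
  | cons x l ih => rw [List.map_cons, List.sum_cons, ← ih]; rfl

theorem len_eq (l : List α) : len l = l.length := by
  induction l with
  | nil => rfl
  | cons x l ih => rw [List.length_cons, ← ih]; rfl

theorem binom_eq (n k : ℕ) : binom n k = n.choose k := by
  induction n generalizing k with
  | zero => cases k <;> rfl
  | succ n ih =>
    cases k with
    | zero => simp [binom]
    | succ k => rw [Nat.choose_succ_succ', ← ih, ← ih]; rfl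

/-! ### Packed vectors -/

/-- The numbers `f x` for `x` in `L`, packed into the lanes (of `96` bits) of one number. -/
def pack (L : List ι) (f : ι → ℕ) : ℕ := Nat.ofDigits (2 ^ 96) (L.map f)

@[simp] theorem pack_nil (f : ι → ℕ) : pack [] f = 0 := rfl

@[simp] theorem pack_cons (x : ι) (L : List ι) (f : ι → ℕ) :
    pack (x :: L) f = f x + 2 ^ 96 * pack L f := by
  simp [pack, Nat.ofDigits_cons]

theorem pack_append (L L' : List ι) (f : ι → ℕ) :
    pack (L ++ L') f = pack L f + 2 ^ (96 * L.length) * pack L' f := by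
  simp [pack, Nat.ofDigits_append, pow_mul]

theorem pack_map (g : α → ι) (L : List α) (f : ι → ℕ) :
    pack (L.map g) f = pack L fun x => f (g x) := by
  simp [pack, Function.comp_def]

theorem pack_congr {L : List ι} {f g : ι → ℕ} (h : ∀ x ∈ L, f x = g x) : pack L f = pack L g := by
  rw [pack, pack, List.map_congr_left h]

theorem pack_add (L : List ι) (f g : ι → ℕ) :
    pack L f + pack L g = pack L fun x => f x + g x := by
  induction L with
  | nil => rfl
  | cons x L ih => rw [pack_cons, pack_cons, pack_cons, ← ih]; ring

theorem pack_mul (L : List ι) (c : ℕ) (f : ι → ℕ) : c * pack L f = pack L fun x => c * f x := by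
  induction L with
  | nil => rfl
  | cons x L ih => rw [pack_cons, pack_cons, ← ih]; ring

/-- No borrow crosses a lane, since every lane of the subtrahend is at most the corresponding lane
of the minuend. -/
theorem pack_sub {L : List ι} {f g : ι → ℕ} (h : ∀ x ∈ L, g x ≤ f x) :
    pack L f - pack L g = pack L fun x => f x - g x := by
  rw [Nat.sub_eq_iff_eq_add', pack_add]
  · exact pack_congr fun x hx => (Nat.add_sub_cancel' (h x hx)).symm
  · rw [pack_congr (g := fun x => g x + (f x - g x)) fun x hx => (Nat.add_sub_cancel' (h x hx)).symm,
      ← pack_add]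
    exact Nat.le_add_right _ _

theorem pack_zero (L : List ι) : (pack L fun _ => 0) = 0 := by
  simpa using (pack_mul L 0 fun _ => 0).symm

theorem pack_list_sum (L : List ι) (l : List α) (f : α → ι → ℕ) :
    (l.map fun y => pack L (f y)).sum = pack L fun x => (l.map fun y => f y x).sum := by
  induction l with
  | nil => simp [pack_zero]
  | cons y l ih => simp only [List.map_cons, List.sum_cons, ih, pack_add]

theorem pack_sum (L : List ι) (n : ℕ) (f : ℕ → ι → ℕ) :
    ∑ i ∈ Finset.range n, pack L (f i) = pack L fun x => ∑ i ∈ Finset.range n, f i x := by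
  induction n with
  | zero => simp [pack_zero]
  | succ n ih => simp only [Finset.sum_range_succ, ih, pack_add]

/-- Bitwise operations do not mix the `n` low bits with the others; this is the induction step for
lane-wise masks. -/
theorem land_add_two_pow_mul {n a b : ℕ} (ha : a < 2 ^ n) (hb : b < 2 ^ n) (x y : ℕ) :
    (a + 2 ^ n * x) &&& (b + 2 ^ n * y) = (a &&& b) + 2 ^ n * (x &&& y) := by
  refine Nat.eq_of_testBit_eq fun i => ?_
  rw [Nat.testBit_land, add_comm a, add_comm b, add_comm (a &&& b),
    Nat.testBit_two_pow_mul_add _ ha, Nat.testBit_two_pow_mul_add _ hb,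
    Nat.testBit_two_pow_mul_add _ (Nat.and_lt_two_pow _ hb)]
  split_ifs <;> simp

theorem pack_land {L : List ι} {f g : ι → ℕ} (hf : ∀ x ∈ L, f x < 2 ^ 96)
    (hg : ∀ x ∈ L, g x < 2 ^ 96) : (pack L f) &&& (pack L g) = pack L fun x => f x &&& g x := by
  induction L with
  | nil => simp
  | cons x L ih =>
    rw [List.forall_mem_cons] at hf hg
    rw [pack_cons, pack_cons, pack_cons, land_add_two_pow_mul hf.1 hg.1, ih hf.2 hg.2]

theorem ones_eq (L : List ι) : ones L.length = pack L fun _ => 1 := by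
  -- The geometric sum with ratio `2 ^ 96`.
  have h (L : List ι) : (2 ^ 96 - 1) * pack L (fun _ => 1) + 1 = 2 ^ (96 * L.length) := by
    induction L with
    | nil => rfl
    | cons x L ih =>
      rw [pack_cons, List.length_cons, Nat.mul_succ, pow_add, ← ih]
      ring
  change (1 <<< (96 * L.length) - 1) / 79228162514264337593543950335 = _
  rw [Nat.shiftLeft_eq, one_mul, ← h, Nat.add_sub_cancel,
    show 79228162514264337593543950335 = 2 ^ 96 - 1 by norm_num, Nat.mul_div_cancel_left]
  norm_num

theorem mul_ones {L : List ι} {m : ℕ} (hm : L.length = m) (c : ℕ) :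
    c * ones m = pack L fun _ => c := by
  rw [← hm, ones_eq, pack_mul]; simp

/-- A bit times `2 ^ n - 1` is a mask that keeps everything or nothing. -/
theorem land_two_pow_sub_one_mul (a n : ℕ) (b : Bool) (h : a < 2 ^ n) :
    a &&& (b.toNat * (2 ^ n - 1)) = b.toNat * a := by
  cases b
  · simp
  · simp [Nat.mod_eq_of_lt h]

/-- Bit 95 serves as a comparison flag: it is set in `f + 2 ^ 95 - g` exactly when `g ≤ f`.
Subtracting the flag shifted to bit 0 turns it into a mask of 95 ones, which extracts `f - g` or
`0`; adding `g` gives the maximum. -/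
theorem vmax_eq {L : List ι} {m : ℕ} (hm : L.length = m) {f g : ι → ℕ}
    (hf : ∀ x ∈ L, f x < 2 ^ 95) (hg : ∀ x ∈ L, g x < 2 ^ 95) :
    vmax m (pack L f) (pack L g) = pack L fun x => max (f x) (g x) := by
  change pack L g + ((pack L f + ones m <<< 95 - pack L g) &&&
    (((pack L f + ones m <<< 95 - pack L g) &&& ones m <<< 95) -
      ((pack L f + ones m <<< 95 - pack L g) &&& ones m <<< 95) >>> 95)) = _
  have hd : pack L f + ones m <<< 95 - pack L g = pack L fun x => f x + 2 ^ 95 - g x := by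
    rw [Nat.shiftLeft_eq, mul_comm, mul_ones hm, pack_add, pack_sub]
    intro x hx
    exact (hg x hx).le.trans (Nat.le_add_left _ _)
  have hb {x} (hx : x ∈ L) : (f x + 2 ^ 95 - g x) &&& 2 ^ 95 = 2 ^ 95 * (decide (g x ≤ f x)).toNat := by
    rw [Nat.and_two_pow, mul_comm]
    congr 2
    have h1 := hf x hx
    have h2 := hg x hx
    rw [Nat.testBit_eq_decide_div_mod_eq]
    by_cases h : g x ≤ f x
    · rw [show (f x + 2 ^ 95 - g x) / 2 ^ 95 = 1 by omega]; simp [h]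
    · rw [show (f x + 2 ^ 95 - g x) / 2 ^ 95 = 0 by omega]; simp [h]
  have hlt {x} (hx : x ∈ L) : f x + 2 ^ 95 - g x < 2 ^ 96 := by
    have h1 := hf x hx
    omega
  have hg' : (pack L f + ones m <<< 95 - pack L g) &&& ones m <<< 95 =
      pack L fun x => 2 ^ 95 * (decide (g x ≤ f x)).toNat := by
    rw [hd, Nat.shiftLeft_eq, mul_comm, mul_ones hm, pack_land (fun x hx => hlt hx)
      (fun x _ => by norm_num)]
    exact pack_congr fun x hx => hb hx
  have hs : (pack L fun x => 2 ^ 95 * (decide (g x ≤ f x)).toNat) >>> 95 =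
      pack L fun x => (decide (g x ≤ f x)).toNat := by
    rw [← pack_mul, Nat.shiftRight_eq_div_pow, Nat.mul_div_cancel_left _ (by positivity)]
  rw [hg', hs, hd, pack_sub (fun x _ => by omega), pack_land (fun x hx => hlt hx), pack_add]
  · refine pack_congr fun x hx => ?_
    have h1 := hf x hx
    have h2 := hg x hx
    by_cases h : g x ≤ f x
    · have : 2 ^ 95 * (decide (g x ≤ f x)).toNat - (decide (g x ≤ f x)).toNat = 2 ^ 95 - 1 := by
        simp [h]
      rw [this, Nat.and_two_pow_sub_one_eq_mod, max_eq_left h]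
      omega
    · simp [h, max_eq_right (le_of_not_ge h)]
  · intro x _
    cases decide (g x ≤ f x) <;> simp

theorem high_eq {L : List ι} {m : ℕ} (hm : L.length = m) {f : ι → ℕ} (hf : ∀ x ∈ L, f x < 2 ^ 96) :
    high m (pack L f) = pack L fun x => f x / 2 ^ 43 := by
  change (pack L f &&& 79228162514264328797450928128 * ones m) >>> 43 = _
  rw [mul_ones hm, pack_land hf (fun _ _ => by norm_num)]
  have h (x) (hx : x ∈ L) : f x &&& 79228162514264328797450928128 = 2 ^ 43 * (f x / 2 ^ 43) := by
    -- The mask is `2 ^ 96 - 2 ^ 43 = 0 + 2 ^ 43 * (2 ^ 53 - 1)`. It clears the low 43 bits of each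
    -- lane, so that the shift moves nothing into the lane below.
    have h1 := land_add_two_pow_mul (n := 43) (a := f x % 2 ^ 43) (b := 0)
      (Nat.mod_lt _ (by positivity)) (by positivity) (f x / 2 ^ 43) (2 ^ 53 - 1)
    have h2 : f x / 2 ^ 43 < 2 ^ 53 := by
      have := hf x hx
      omega
    rw [Nat.mod_add_div, Nat.and_two_pow_sub_one_eq_mod, Nat.mod_eq_of_lt h2] at h1
    simpa using h1
  rw [pack_congr h, ← pack_mul, Nat.shiftRight_eq_div_pow, Nat.mul_div_cancel_left _ (by positivity)]

theorem sum_testBit_mul_two_pow (a n : ℕ) :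
    ∑ i ∈ Finset.range n, (a.testBit i).toNat * 2 ^ i = a % 2 ^ n := by
  induction n with
  | zero => simp [Nat.mod_one]
  | succ n ih =>
    rw [Finset.sum_range_succ, ih, Nat.mod_pow_succ, Nat.toNat_testBit]
    ring

/-- Long multiplication in base two: bit `i` of each lane, expanded to a mask by the factor
`8589934591 = 2 ^ 33 - 1`, selects the lane or zero, which is then shifted by `i`. -/
theorem squares_eq {L : List ι} {m : ℕ} (hm : L.length = m) {f : ι → ℕ}
    (hf : ∀ x ∈ L, f x < 2 ^ 33) : squares m (pack L f) = pack L fun x => f x ^ 2 := by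
  rw [squares, nsum_eq]
  have h (i : ℕ) (hi : i ∈ Finset.range 33) :
      (((pack L f &&& 2 ^ i * ones m) >>> i * 8589934591) &&& pack L f) <<< i =
        pack L fun x => f x * ((f x).testBit i).toNat * 2 ^ i := by
    have hi : i < 33 := Finset.mem_range.1 hi
    have h33 : 2 ^ i < 2 ^ 96 := Nat.pow_lt_pow_right (by norm_num) (by omega)
    have hf96 (x) (hx : x ∈ L) : f x < 2 ^ 96 := (hf x hx).trans (by norm_num)
    rw [mul_ones hm, pack_land hf96 (fun _ _ => h33), pack_congr
      (g := fun x => 2 ^ i * ((f x).testBit i).toNat) (fun x _ => by rw [Nat.and_two_pow, mul_comm]),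
      ← pack_mul, Nat.shiftRight_eq_div_pow, Nat.mul_div_cancel_left _ (by positivity), mul_comm,
      pack_mul, pack_land _ hf96, Nat.shiftLeft_eq, mul_comm, pack_mul]
    · refine pack_congr fun x hx => ?_
      rw [Nat.and_comm, mul_comm 8589934591, show 8589934591 = 2 ^ 33 - 1 by norm_num,
        land_two_pow_sub_one_mul _ _ _ (hf x hx)]
      ring
    · intro x _
      cases (f x).testBit i <;> norm_num
  refine (Finset.sum_congr rfl h).trans ?_
  rw [pack_sum]
  refine pack_congr fun x hx => ?_
  simp only [mul_assoc]
  rw [← Finset.mul_sum, sum_testBit_mul_two_pow, Nat.mod_eq_of_lt (hf x hx), sq]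

theorem laneSum_eq {L : List ι} {m : ℕ} (hm : L.length = m) {f : ι → ℕ}
    (hf : ∀ x ∈ L, f x < 2 ^ 96) : laneSum m (pack L f) = (L.map f).sum := by
  subst hm
  induction L with
  | nil => rfl
  | cons x L ih =>
    rw [List.forall_mem_cons] at hf
    change pack (x :: L) f % 2 ^ 96 + laneSum L.length (pack (x :: L) f >>> 96) = _
    rw [pack_cons, Nat.shiftRight_eq_div_pow, Nat.add_mul_mod_self_left, Nat.mod_eq_of_lt hf.1,
      Nat.add_mul_div_left _ _ (by positivity), Nat.div_eq_of_lt hf.1, zero_add, ih hf.2]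
    simp

end Eval

/-! ### Total weights of the hands that contain some cards and avoid others -/

section Weights

open Finset

/-- The total weight of the five-card hands that contain `s` and are disjoint from `D`. -/
def containSum (w : Finset Card → ℕ) (s D : Finset Card) : ℕ :=
  ∑ f ∈ (univ.powersetCard 5 : Finset (Finset Card)) with s ⊆ f ∧ Disjoint f D, w f

variable (w : Finset Card → ℕ)

/-- A final hand contains `x` or avoids it. Read as a subtraction, this yields the sums with
discards from those without. -/
theorem containSum_insert (x : Card) (s D : Finset Card) :
    containSum w s D = containSum w (insert x s) D + containSum w s (insert x D) := by
  rw [containSum, ← sum_filter_add_sum_filter_not _ fun f => x ∈ f, filter_filter, filter_filter]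
  congr 1
  · refine sum_congr (filter_congr fun f _ => ?_) fun _ _ => rfl
    rw [insert_subset_iff]
    tauto
  · refine sum_congr (filter_congr fun f _ => ?_) fun _ _ => rfl
    rw [disjoint_insert_right]
    tauto

theorem containSum_of_card_eq {s : Finset Card} (hs : s.card = 5) : containSum w s ∅ = w s := by
  rw [containSum, sum_eq_single_of_mem s (by simp [hs])]
  intro f hf hne
  simp only [mem_filter, mem_powersetCard] at hf
  exact absurd (eq_of_subset_of_card_le hf.2.1 (by omega)).symm hne

/-- Double counting: a five-card hand containing `s` has exactly `k` cards outside `s`. -/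
theorem mul_containSum {s : Finset Card} {k : ℕ} (hs : s.card + k = 5) :
    k * containSum w s ∅ = ∑ x ∈ sᶜ, containSum w (insert x s) ∅ := by
  simp only [containSum, sum_filter]
  rw [sum_comm, mul_sum]
  refine sum_congr rfl fun f hf => ?_
  have hf5 : f.card = 5 := (mem_powersetCard.1 hf).2
  by_cases h : s ⊆ f
  · have : ∀ x ∈ sᶜ, (if insert x s ⊆ f ∧ Disjoint f ∅ then w f else 0) =
        if x ∈ f then w f else 0 := fun x _ => by simp [insert_subset_iff, h]
    rw [sum_congr rfl this, ← sum_filter, sum_const, if_pos (by simpa using h), smul_eq_mul]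
    congr 1
    rw [show sᶜ.filter (· ∈ f) = f \ s by ext; simp [and_comm], card_sdiff_of_subset h]
    omega
  · rw [if_neg (fun h' => h h'.1), mul_zero]
    exact (sum_eq_zero fun x _ => if_neg fun h' => h ((subset_insert x s).trans h'.1)).symm

theorem containSum_add (w w' : Finset Card → ℕ) (s D : Finset Card) :
    containSum (fun f => w f + w' f) s D = containSum w s D + containSum w' s D :=
  sum_add_distrib

theorem containSum_sum {ι : Type*} (t : Finset ι) (w : ι → Finset Card → ℕ) (s D : Finset Card) :
    containSum (fun f => ∑ i ∈ t, w i f) s D = ∑ i ∈ t, containSum (w i) s D :=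
  sum_comm

theorem containSum_congr {w w' : Finset Card → ℕ} (h : ∀ f, f.card = 5 → w f = w' f)
    (s D : Finset Card) : containSum w s D = containSum w' s D :=
  sum_congr rfl fun f hf => h f (mem_powersetCard.1 (mem_filter.1 hf).1).2

/-- Draws correspond to final hands, by adding or removing `s`; a draw avoids the initial hand, so
the final hand avoids just the discards. -/
theorem sum_powersetCard_compl {h s : Finset Card} (hh : h.card = 5) (hs : s ⊆ h) :
    ∑ d ∈ hᶜ.powersetCard (5 - s.card), w (s ∪ d) = containSum w s (h \ s) := by
  have hsc := card_le_card hs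
  refine sum_nbij' (fun d => s ∪ d) (fun f => f \ s) ?_ ?_ ?_ ?_ ?_
  · intro d hd
    simp only [mem_powersetCard, mem_filter, subset_univ, true_and] at hd ⊢
    have hdh : Disjoint h d := disjoint_left.2 fun x hx hx' => (mem_compl.1 (hd.1 hx')) hx
    refine ⟨?_, subset_union_left, ?_⟩
    · rw [card_union_of_disjoint (disjoint_of_subset_left hs hdh), hd.2]
      omega
    · rw [disjoint_union_left]
      exact ⟨disjoint_sdiff, (disjoint_of_subset_left sdiff_subset hdh).symm⟩
  · intro f hf
    simp only [mem_powersetCard, mem_filter, subset_univ, true_and] at hf ⊢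
    refine ⟨fun x hx => ?_, by rw [card_sdiff_of_subset hf.2.1, hf.1]⟩
    rw [mem_compl]
    intro hxh
    rw [mem_sdiff] at hx
    exact disjoint_left.1 hf.2.2 hx.1 (mem_sdiff.2 ⟨hxh, hx.2⟩)
  · intro d hd
    simp only [mem_powersetCard] at hd
    have hdh : Disjoint h d := disjoint_left.2 fun x hx hx' => (mem_compl.1 (hd.1 hx')) hx
    rw [union_sdiff_left, sdiff_eq_self_of_disjoint (disjoint_of_subset_left hs hdh).symm]
  · intro f hf
    simp only [mem_filter] at hf
    exact union_sdiff_of_subset hf.2.1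
  · intro d _
    rfl

end Weights

/-! ### The tables -/

section Tables

open Finset

/-- In a sorted list, all copies of a lower bound stand at the front. -/
theorem leading_eq {r : ℕ} {v : List ℕ} (hv : v.Pairwise (· ≤ ·)) (hr : ∀ x ∈ v, r ≤ x) :
    leading r v = v.count r := by
  induction v with
  | nil => rfl
  | cons x v ih =>
    rw [List.pairwise_cons] at hv
    rw [List.forall_mem_cons] at hr
    change sel (Nat.beq r x) (leading r v + 1) 0 = _
    rw [sel_eq, ih hv.2 hr.2, List.count_cons]
    by_cases h : r = x
    · simp [h]
    · have : List.count r v = 0 := List.count_eq_zero.2 fun hm => h (le_antisymm hr.1 (hv.1 r hm))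
      simp [h, Ne.symm h, this]

theorem insertK_eq (r : ℕ) {v : List ℕ} (hv : v.Pairwise (· ≤ ·)) (K : ℕ → List ℕ → ℕ) :
    insertK r v K = K (v.count r) (v.orderedInsert (· ≤ ·) r) := by
  induction v generalizing K with
  | nil => rfl
  | cons x v ih =>
    change sel (Nat.ble r x) (K (leading r (x :: v)) (r :: x :: v))
      (insertK r v fun n w => K n (x :: w)) = _
    have hv' := List.pairwise_cons.1 hv
    rw [sel_eq, ih hv'.2, List.orderedInsert_cons]
    by_cases h : r ≤ x
    · rw [if_pos (by simpa using h), if_pos h, leading_eq hv]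
      rw [List.forall_mem_cons]
      exact ⟨h, fun y hy => h.trans (hv'.1 y hy)⟩
    · rw [if_neg (by simpa using h), if_neg h, List.count_cons_of_ne (by omega)]

theorem table_succ (q : ℕ) (base : List ℕ → ℕ) (k : ℕ) {v : List ℕ} (hv : v.Pairwise (· ≤ ·)) :
    table q base (k + 1) v =
      (∑ r ∈ range 13, (q - v.count r) * table q base k (v.orderedInsert (· ≤ ·) r)) / (k + 1) := by
  change nsum 13 (fun r => insertK r v fun n w => @Nat.rec (fun _ => ℕ) 0
    (fun c _ => (c + 1) * table q base k w) (q - n)) / (k + 1) = _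
  rw [nsum_eq]
  congr 1
  refine sum_congr rfl fun r _ => ?_
  rw [insertK_eq r hv]
  cases q - v.count r <;> simp

/-- The denominations of the cards in `f`. -/
def rankMultiset (f : Finset Card) : Multiset ℕ := f.val.map fun c => (c.1 : ℕ)

theorem rankMultiset_insert {x : Card} {s : Finset Card} (hx : x ∉ s) :
    rankMultiset (insert x s) = (x.1 : ℕ) ::ₘ rankMultiset s := by
  rw [rankMultiset, insert_val_of_notMem hx, Multiset.map_cons, rankMultiset]

theorem card_rankMultiset (f : Finset Card) : (rankMultiset f).card = f.card := by
  simp [rankMultiset]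

theorem count_rankMultiset (f : Finset Card) (r : Fin 13) :
    (rankMultiset f).count (r : ℕ) = rankCount f r := by
  rw [rankMultiset, Multiset.count_map, rankCount, card_def, filter_val]
  congr 1
  refine Multiset.filter_congr fun c _ => ?_
  rw [Fin.val_inj]
  exact eq_comm

/-- The denominations of the cards in `f`, sorted. -/
def rankList (f : Finset Card) : List ℕ := (rankMultiset f).sort (· ≤ ·)

theorem rankList_eq {f : Finset Card} {v : List ℕ} (hv : v.Pairwise (· ≤ ·))
    (h : (v : Multiset ℕ) = rankMultiset f) : rankList f = v := by
  rw [rankList, ← h]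
  exact (Multiset.coe_eq_coe.1 (Multiset.sort_eq _ _)).eq_of_pairwise'
    (Multiset.pairwise_sort _ _) hv

/-- The recursion `mul_containSum`, with the added card grouped by denomination: `q - v.count r`
cards of denomination `r` are left in `S`. The division in the table is therefore exact. It is
applied with `S` the full deck (`q = 4`) and with `S` one suit (`q = 1`). -/
theorem containSum_eq_table {S : Finset Card} {q : ℕ} {base : List ℕ → ℕ}
    (hS : ∀ r : Fin 13, (S.filter fun c => c.1 = r).card = q) {k : ℕ} {s : Finset Card}
    (hs : s.card + k = 5) (hsS : s ⊆ S) {v : List ℕ} (hv : v.Pairwise (· ≤ ·))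
    (hvs : (v : Multiset ℕ) = rankMultiset s) :
    containSum (fun f => if f ⊆ S then base (rankList f) else 0) s ∅ = table q base k v := by
  induction k generalizing s v with
  | zero =>
    rw [containSum_of_card_eq _ (by simpa using hs), if_pos hsS, rankList_eq hv hvs]
    rfl
  | succ k ih =>
    rw [table_succ q base k hv]
    refine (Nat.div_eq_of_eq_mul_right (Nat.succ_pos k) ?_).symm
    rw [mul_containSum _ hs, sum_range]
    have h (x) (hx : x ∈ sᶜ) :
        containSum (fun f => if f ⊆ S then base (rankList f) else 0) (insert x s) ∅ =
        if x ∈ S then table q base k (v.orderedInsert (· ≤ ·) (x.1 : ℕ)) else 0 := by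
      rw [mem_compl] at hx
      split_ifs with hxS
      · refine ih ?_ (insert_subset hxS hsS) ?_ ?_
        · rw [card_insert_of_notMem hx]
          omega
        · exact List.Pairwise.orderedInsert _ _ hv
        · rw [rankMultiset_insert hx, ← hvs, Multiset.cons_coe, Multiset.coe_eq_coe]
          exact List.perm_orderedInsert _ _ _
      · refine sum_eq_zero fun f hf => if_neg fun hfS => hxS ?_
        exact hfS ((mem_filter.1 hf).2.1 (mem_insert_self x s))
    rw [sum_congr rfl h, ← sum_filter, ← sum_fiberwise (g := Prod.fst)]
    refine sum_congr rfl fun r _ => ?_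
    rw [sum_congr rfl (g := fun _ => table q base k (v.orderedInsert (· ≤ ·) (r : ℕ)))
      fun x hx => by rw [(mem_filter.1 hx).2], sum_const, smul_eq_mul]
    congr 1
    rw [← Multiset.coe_count, hvs, count_rankMultiset, rankCount, ← hS r,
      ← card_sdiff_of_subset (filter_subset_filter _ hsS)]
    congr 1
    ext x
    simp only [mem_filter, mem_compl, mem_sdiff]
    tauto

end Tables

/-! ### The payout in terms of the sorted denominations -/

section Payout

open Finset

variable {f : Finset Card} {a b c d e : ℕ}

theorem coe_rankList (f : Finset Card) : (rankList f : Multiset ℕ) = rankMultiset f :=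
  Multiset.sort_eq _ _

theorem pairwise_rankList (f : Finset Card) : (rankList f).Pairwise (· ≤ ·) :=
  Multiset.pairwise_sort _ _

theorem count_rankList (f : Finset Card) (r : Fin 13) : (rankList f).count (r : ℕ) = rankCount f r := by
  rw [← Multiset.coe_count, coe_rankList, count_rankMultiset]

theorem rankCount_le (f : Finset Card) (r : Fin 13) : rankCount f r ≤ 4 := by
  calc rankCount f r ≤ ((univ : Finset Card).filter fun c => c.1 = r).card :=
        card_le_card (filter_subset_filter _ (subset_univ f))
    _ = 4 := by revert r; decide

theorem mem_rankList {f : Finset Card} {n : ℕ} : n ∈ rankList f ↔ ∃ c ∈ f, (c.1 : ℕ) = n := by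
  rw [← Multiset.mem_coe, coe_rankList, rankMultiset, Multiset.mem_map]
  rfl

theorem lt_of_mem_rankList {f : Finset Card} {n : ℕ} (h : n ∈ rankList f) : n < 13 := by
  obtain ⟨c, -, rfl⟩ := mem_rankList.1 h
  exact c.1.2

theorem image_ranks (f : Finset Card) : (ranks f).image (fun r => r.val) = (rankList f).toFinset := by
  ext n
  simp [ranks, mem_rankList]

theorem ranks_eq_iff (f : Finset Card) (s : Finset (Fin 13)) :
    ranks f = s ↔ (rankList f).toFinset = s.image fun r => r.val := by
  rw [← image_ranks]
  exact (Finset.image_injective Fin.val_injective).eq_iff.symm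

/-- A nonzero count forces the denomination to occur, so the search over thirteen denominations
becomes one over five list entries. -/
theorem exists_rankCount_iff {n : ℕ} (hn : n ≠ 0) :
    (∃ r, rankCount f r = n) ↔ ∃ r ∈ rankList f, (rankList f).count r = n := by
  constructor
  · rintro ⟨r, hr⟩
    rw [← count_rankList] at hr
    exact ⟨r, List.count_pos_iff.1 (by omega), hr⟩
  · rintro ⟨r, hr, h⟩
    exact ⟨⟨r, lt_of_mem_rankList hr⟩, by rw [← count_rankList, h]⟩

theorem exists_le_rankCount_iff :
    (∃ r, 9 ≤ r ∧ rankCount f r = 2) ↔ ∃ r ∈ rankList f, 9 ≤ r ∧ (rankList f).count r = 2 := by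
  constructor
  · rintro ⟨r, h9, hr⟩
    rw [← count_rankList] at hr
    exact ⟨r, List.count_pos_iff.1 (by omega), h9, hr⟩
  · rintro ⟨r, hr, h9, h⟩
    exact ⟨⟨r, lt_of_mem_rankList hr⟩, h9, by rw [← count_rankList, h]⟩

theorem card_filter_rankCount {n : ℕ} (hn : n ≠ 0) :
    (univ.filter fun r => rankCount f r = n).card =
      ((rankList f).toFinset.filter fun r => (rankList f).count r = n).card := by
  rw [← card_map Fin.valEmbedding]
  congr 1
  ext m
  simp only [mem_map, mem_filter, mem_univ, true_and, List.mem_toFinset, Fin.valEmbedding_apply]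
  constructor
  · rintro ⟨r, hr, rfl⟩
    rw [← count_rankList] at hr
    exact ⟨List.count_pos_iff.1 (by omega), hr⟩
  · rintro ⟨hm, h⟩
    exact ⟨⟨m, lt_of_mem_rankList hm⟩, by rw [← count_rankList, h], rfl⟩

/-- The denominations, in increasing order, are those of a straight. -/
def StraightList (a d e : ℕ) : Prop := e = a + 4 ∨ d = 3 ∧ e = 12

theorem toFinset_eq_Icc_iff (h : a < b ∧ b < c ∧ c < d ∧ d < e) (k : ℕ) :
    [a, b, c, d, e].toFinset = Icc k (k + 4) ↔ a = k ∧ e = k + 4 := by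
  simp only [Finset.ext_iff, List.mem_toFinset, List.mem_cons, List.not_mem_nil, or_false, mem_Icc]
  constructor
  · intro H
    have h1 := (H a).1 (by simp)
    have h2 := (H e).1 (by simp)
    omega
  · intro H n
    omega

theorem toFinset_eq_low_iff (h : a < b ∧ b < c ∧ c < d ∧ d < e) :
    [a, b, c, d, e].toFinset = {12, 0, 1, 2, 3} ↔ d = 3 ∧ e = 12 := by
  simp only [Finset.ext_iff, List.mem_toFinset, List.mem_cons, List.not_mem_nil, or_false,
    mem_insert, mem_singleton]
  constructor
  · intro H
    have h1 := (H d).1 (by simp)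
    have h2 := (H e).1 (by simp)
    omega
  · intro H n
    omega

theorem not_toFinset_of_eq (h : a = b ∨ b = c ∨ c = d ∨ d = e) {s : Finset ℕ} (hs : s.card = 5) :
    [a, b, c, d, e].toFinset ≠ s := by
  intro H
  have h1 := List.toFinset_card_of_nodup (l := [a, b, c, d, e])
  have h2 : [a, b, c, d, e].dedup.length = [a, b, c, d, e].length := by
    rw [← List.card_toFinset, H, hs]; rfl
  have h3 := (List.dedup_sublist [a, b, c, d, e]).eq_of_length h2
  have h4 := List.dedup_eq_self.1 h3
  simp at h4
  omega

variable (hv : rankList f = [a, b, c, d, e])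
include hv

theorem isStraight_iff (h : a < b ∧ b < c ∧ c < d ∧ d < e) :
    IsStraight f ↔ StraightList a d e := by
  have he : e < 13 := lt_of_mem_rankList (f := f) (by rw [hv]; simp)
  rw [IsStraight, StraightList, ranks_eq_iff, image_ranks, hv, or_comm]
  refine or_congr ?_ ?_
  · simp only [toFinset_eq_Icc_iff h, mem_range]
    constructor
    · rintro ⟨k, hk, rfl, rfl⟩
      rfl
    · rintro rfl
      exact ⟨a, by omega, rfl, rfl⟩
  · rw [← toFinset_eq_low_iff h]
    rfl

theorem isRoyal_iff (h : a < b ∧ b < c ∧ c < d ∧ d < e) :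
    ranks f = {8, 9, 10, 11, 12} ↔ a = 8 ∧ e = 12 := by
  rw [ranks_eq_iff, hv, ← toFinset_eq_Icc_iff h 8]
  rfl

theorem not_isStraight (h : a = b ∨ b = c ∨ c = d ∨ d = e) : ¬ IsStraight f := by
  rw [IsStraight, ranks_eq_iff, image_ranks, hv]
  rintro (H | ⟨k, -, H⟩)
  · exact not_toFinset_of_eq h (by rfl) H
  · exact not_toFinset_of_eq h (by rw [Nat.card_Icc]; omega) H

theorem sorted_of_rankList_eq : a ≤ b ∧ b ≤ c ∧ c ≤ d ∧ d ≤ e := by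
  have := pairwise_rankList f
  rw [hv] at this
  simp at this
  omega

/-- There are only four cards of a denomination. The case has to be excluded because `rankPay` would
treat it as four of a kind. -/
theorem not_all_eq : a ≠ e := by
  intro h
  have hs := sorted_of_rankList_eq hv
  have ha : a < 13 := lt_of_mem_rankList (f := f) (by rw [hv]; simp)
  have h1 := rankCount_le f ⟨a, ha⟩
  rw [← count_rankList, hv] at h1
  obtain rfl : a = b := by omega
  obtain rfl : a = c := by omega
  obtain rfl : a = d := by omega
  obtain rfl : a = e := by omega
  simp at h1

/-- Cards of one suit are determined by their denominations. -/
theorem strict_of_isFlush (h : IsFlush f) : a < b ∧ b < c ∧ c < d ∧ d < e := by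
  obtain ⟨q, hq⟩ := h
  have hnd : (rankList f).Nodup := by
    rw [← Multiset.coe_nodup, coe_rankList, rankMultiset]
    refine Multiset.Nodup.map_on (fun x hx y hy hxy => ?_) f.nodup
    exact Prod.ext (Fin.ext hxy) ((hq x hx).trans (hq y hy).symm)
  have hs := sorted_of_rankList_eq hv
  rw [hv] at hnd
  simp at hnd
  omega

theorem payout_of_isFlush (h : IsFlush f) : payout f = flushPay a d e := by
  have hs := strict_of_isFlush hv h
  have he : e < 13 := lt_of_mem_rankList (f := f) (by rw [hv]; simp)
  have h1 (n : ℕ) (hn : 2 ≤ n) : ¬ ∃ r, rankCount f r = n := by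
    rw [exists_rankCount_iff (by omega), hv]
    simp only [List.mem_cons, List.not_mem_nil, or_false, List.count_cons, List.count_nil, beq_iff_eq]
    rintro ⟨r, -, hr⟩
    split_ifs at hr <;> omega
  simp only [payout, h, true_and, isRoyal_iff hv hs, isStraight_iff hv hs, h1 4 (by omega),
    h1 3 (by omega), false_and, if_false, if_true, StraightList, flushPay, sel_eq,
    Nat.beq_eq, Nat.add_eq]
  split_ifs <;> first | rfl | omega

set_option maxHeartbeats 1600000 in
theorem payout_of_not_isFlush (h : ¬ IsFlush f) : payout f = rankPay a b c d e := by
  have hs := sorted_of_rankList_eq hv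
  have hae := not_all_eq hv
  by_cases hst : a < b ∧ b < c ∧ c < d ∧ d < e
  · have h1 (n : ℕ) (hn : 2 ≤ n) : ¬ ∃ r, rankCount f r = n := by
      rw [exists_rankCount_iff (by omega), hv]
      simp only [List.mem_cons, List.not_mem_nil, or_false, List.count_cons, List.count_nil, beq_iff_eq]
      rintro ⟨r, -, hr⟩
      split_ifs at hr <;> omega
    have h2 : ¬ ∃ r, 9 ≤ r ∧ rankCount f r = 2 := fun ⟨r, hr⟩ => h1 2 le_rfl ⟨r, hr.2⟩
    have h3 : (univ.filter fun r => rankCount f r = 2).card ≠ 2 := by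
      rw [filter_false_of_mem fun r _ hr => h1 2 le_rfl ⟨r, hr⟩]
      simp
    have he : e < 13 := lt_of_mem_rankList (f := f) (by rw [hv]; simp)
    simp only [payout, h, false_and, isStraight_iff hv hst, h1 4 (by omega),
      h1 3 (by omega), h2, h3, if_false, StraightList, rankPay, sel_eq,
      Nat.beq_eq, Nat.add_eq]
    split_ifs <;> first | rfl | omega
  · have h1 := not_isStraight hv (f := f) (by omega)
    simp only [payout, h, false_and, if_false, h1, exists_rankCount_iff, exists_le_rankCount_iff,
      card_filter_rankCount, hv, ne_eq, OfNat.ofNat_ne_zero, not_false_eq_true, rankPay, sel_eq,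
      Nat.beq_eq, Nat.ble_eq]
    clear h1 hv
    obtain ⟨h1, h2, h3, h4⟩ := hs
    -- Each pattern of equalities between neighbours fixes all multiplicities; the patterns with all
    -- entries equal or all distinct are contradictory here.
    rcases eq_or_lt_of_le h1 with rfl | h1 <;> rcases eq_or_lt_of_le h2 with rfl | h2 <;>
      rcases eq_or_lt_of_le h3 with rfl | h3 <;> rcases eq_or_lt_of_le h4 with rfl | h4 <;>
      try (exfalso; omega)
    all_goals
      simp (disch := omega) only [List.mem_cons, List.not_mem_nil, or_false, exists_eq_or_imp,
        exists_eq_left, List.count_cons, List.count_nil, beq_iff_eq, if_pos, if_neg,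
        List.toFinset_cons, List.toFinset_nil, filter_insert, insert_empty_eq,
        filter_singleton, insert_idem, pair_eq_singleton, card_singleton, card_empty, if_true, reduceIte,
        Nat.reduceAdd, Nat.reduceEqDiff, or_self, and_self, and_true, and_false,
        or_true, false_or]
      try rw [card_pair (by omega)]
      try (split_ifs <;> first | rfl | omega)

end Payout

/-! ### Values of hands -/

section Values

open Finset

/-- The expected weight, times `7669695`, if the cards `s` of the initial hand `h` are held. -/
noncomputable def value (w : Finset Card → ℕ) (h s : Finset Card) : ℕ :=
  scale s.card * containSum w s (h \ s)

/-- The maximum of `value w h s` over all `s`. -/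
noncomputable def maxValue (w : Finset Card → ℕ) (h : Finset Card) : ℕ :=
  h.powerset.sup (value w h)

/-- A common denominator for all sizes of the draw makes the values of different holds comparable as
natural numbers. -/
theorem scale_mul_choose {k : ℕ} (hk : k ≤ 5) : scale k * Nat.choose 47 (5 - k) = 7669695 := by
  interval_cases k <;> rfl

theorem value_le {w : Finset Card → ℕ} {C : ℕ} (hC : ∀ f, w f ≤ C) {h s : Finset Card}
    (hh : h.card = 5) (hs : s ⊆ h) : value w h s ≤ 7669695 * C := by
  have hsc : s.card ≤ 5 := hh ▸ card_le_card hs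
  rw [value, ← sum_powersetCard_compl w hh hs, ← scale_mul_choose hsc, mul_assoc]
  refine Nat.mul_le_mul_left _ ((sum_le_sum fun d _ => hC (s ∪ d)).trans (le_of_eq ?_))
  rw [sum_const, card_powersetCard, card_compl, hh, smul_eq_mul]
  rfl

/-- The maximum over all ways to hold or discard the cards `xs` when the `k` cards `s` are held
and the cards `D` are discarded. -/
noncomputable def holdMax (w : Finset Card → ℕ) : List Card → ℕ → Finset Card → Finset Card → ℕ
  | [], k, s, D => scale k * containSum w s D
  | x :: xs, k, s, D =>
      max (holdMax w xs (k + 1) (insert x s) D) (holdMax w xs k s (insert x D))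

/-- The hand `h` consists of the held cards `s`, the discarded cards `D` and the cards `xs`. -/
structure Splits (h s D : Finset Card) (xs : List Card) : Prop where
  hold : s ⊆ h
  discard : D ⊆ h
  disj : Disjoint s D
  nodup : xs.Nodup
  rest : h \ (s ∪ D) = xs.toFinset

theorem Splits.cons_hold {h s D : Finset Card} {x : Card} {xs : List Card}
    (H : Splits h s D (x :: xs)) : x ∉ s ∧ x ∉ D ∧ Splits h (insert x s) D xs := by
  have hx : x ∈ h \ (s ∪ D) := by simp [H.rest]
  simp only [mem_sdiff, mem_union, not_or] at hx
  have hn := List.nodup_cons.1 H.nodup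
  refine ⟨hx.2.1, hx.2.2, insert_subset hx.1 H.hold, H.discard,
    disjoint_insert_left.2 ⟨hx.2.2, H.disj⟩, hn.2, ?_⟩
  rw [insert_union, sdiff_insert, H.rest, List.toFinset_cons, erase_insert (by simpa using hn.1)]

theorem Splits.cons_discard {h s D : Finset Card} {x : Card} {xs : List Card}
    (H : Splits h s D (x :: xs)) : Splits h s (insert x D) xs := by
  have hx : x ∈ h \ (s ∪ D) := by simp [H.rest]
  simp only [mem_sdiff, mem_union, not_or] at hx
  have hn := List.nodup_cons.1 H.nodup
  refine ⟨H.hold, insert_subset hx.1 H.discard,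
    disjoint_insert_right.2 ⟨hx.2.1, H.disj⟩, hn.2, ?_⟩
  rw [union_insert, sdiff_insert, H.rest, List.toFinset_cons, erase_insert (by simpa using hn.1)]

/-- The admissible holds split according to whether the next card is kept; when no card is left, `D
= h \ s` and `s` is the only one. -/
theorem holdMax_eq (w : Finset Card → ℕ) {h s D : Finset Card} {xs : List Card}
    (H : Splits h s D xs) : holdMax w xs s.card s D =
      (h.powerset.filter fun t => s ⊆ t ∧ Disjoint t D).sup (value w h) := by
  induction xs generalizing s D with
  | nil =>
    have hD : D = h \ s := by
      have := H.rest
      rw [List.toFinset_nil, sdiff_eq_empty_iff_subset] at this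
      ext x
      have h1 := @this x
      have h2 := @H.discard x
      have h3 : x ∈ s → x ∉ D := fun h => disjoint_left.1 H.disj h
      simp only [mem_union, mem_sdiff] at h1 ⊢
      tauto
    have : (h.powerset.filter fun t => s ⊆ t ∧ Disjoint t D) = {s} := by
      ext t
      simp only [mem_filter, mem_powerset, mem_singleton]
      constructor
      · rintro ⟨h1, h2, h3⟩
        refine (h2.antisymm fun x hx => ?_).symm
        by_contra hxs
        exact disjoint_left.1 h3 hx (hD ▸ mem_sdiff.2 ⟨h1 hx, hxs⟩)
      · rintro rfl
        exact ⟨H.hold, subset_rfl, H.disj⟩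
    rw [this, sup_singleton, holdMax, value, ← hD]
  | cons x xs ih =>
    obtain ⟨hs, hD, H1⟩ := H.cons_hold
    have h1 := ih H1
    rw [card_insert_of_notMem hs] at h1
    rw [holdMax, h1, ih H.cons_discard]
    refine Finset.sup_union.symm.trans ?_
    congr 1
    ext t
    simp only [mem_union, mem_filter, mem_powerset, insert_subset_iff, disjoint_insert_right]
    tauto

theorem splits_toFinset {xs : List Card} (h : xs.Nodup) : Splits xs.toFinset ∅ ∅ xs :=
  ⟨empty_subset _, empty_subset _, disjoint_empty_left _, h, by simp⟩

theorem holdMax_eq_maxValue (w : Finset Card → ℕ) {xs : List Card} (h : xs.Nodup) :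
    holdMax w xs 0 ∅ ∅ = maxValue w xs.toFinset := by
  have := holdMax_eq w (splits_toFinset h)
  simpa [maxValue] using this

theorem holdMax_le {w : Finset Card → ℕ} {C : ℕ} (hC : ∀ f, w f ≤ C) {h s D : Finset Card}
    {xs : List Card} (hh : h.card = 5) (H : Splits h s D xs) :
    holdMax w xs s.card s D ≤ 7669695 * C := by
  rw [holdMax_eq w H]
  exact Finset.sup_le fun t ht => value_le hC hh (mem_powerset.1 (mem_filter.1 ht).1)

end Values

/-! ### Weights of hands -/

section HandWeight

open Finset

/-- The weight of a final hand. -/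
noncomputable def handWeight (plus : Bool) (f : Finset Card) : ℕ := weight plus (payout f)

/-- The cards of a suit. -/
def suitCards (q : Fin 4) : Finset Card := univ.filter fun c => c.2 = q

theorem subset_suitCards {q : Fin 4} {s : Finset Card} : s ⊆ suitCards q ↔ ∀ c ∈ s, c.2 = q := by
  simp [suitCards, subset_iff]

theorem payout_le (f : Finset Card) : payout f ≤ 800 := by
  unfold payout
  split_ifs <;> norm_num

theorem weight_true (p : ℕ) : weight true p = p * 2 ^ 43 + p ^ 2 := by
  rw [sq]; rfl

theorem weight_false (p : ℕ) : weight false p = p * 2 ^ 43 - p ^ 2 := by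
  rw [sq]; rfl

/-- Needed so that the truncated subtraction in `flushBonus` is a true one. For the minus sign,
squares grow by at most 1600 per unit in this range, far less than `2 ^ 43`. -/
theorem weight_mono (plus : Bool) {p p' : ℕ} (h : p ≤ p') (h' : p' ≤ 800) :
    weight plus p ≤ weight plus p' := by
  obtain ⟨k, rfl⟩ := Nat.exists_eq_add_of_le h
  cases plus
  · rw [weight_false, weight_false]
    have : (p + k) ^ 2 ≤ p ^ 2 + k * 1600 := by nlinarith
    have h3 : p ^ 2 ≤ p * 2 ^ 43 := by nlinarith
    omega
  · rw [weight_true, weight_true]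
    gcongr

theorem handWeight_le (plus : Bool) (f : Finset Card) : handWeight plus f ≤ 2 ^ 53 := by
  refine (weight_mono plus (payout_le f) le_rfl).trans ?_
  cases plus <;> simp [weight_true, weight_false]

theorem length_rankList (f : Finset Card) : (rankList f).length = f.card := by
  rw [← Multiset.coe_card, coe_rankList, card_rankMultiset]

theorem rankPay_le_flushPay (a b c d e : ℕ) (h : a < b ∧ b < c ∧ c < d ∧ d < e) :
    rankPay a b c d e ≤ flushPay a d e := by
  simp only [rankPay, flushPay, sel_eq, Nat.beq_eq, Nat.ble_eq, Nat.add_eq]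
  split_ifs <;> omega

theorem flushPay_le (a d e : ℕ) : flushPay a d e ≤ 800 := by
  simp only [flushPay, sel_eq]
  split_ifs <;> omega

/-- The weight as if there were no flushes, plus a correction in the one suit, if any, that contains
the hand. Both parts depend only on denominations within a fixed set of cards, as
`containSum_eq_table` requires. -/
theorem handWeight_eq (plus : Bool) {f : Finset Card} (hf : f.card = 5) :
    handWeight plus f = (if f ⊆ univ then rankWeight plus (rankList f) else 0) +
      ∑ q : Fin 4, if f ⊆ suitCards q then flushBonus plus (rankList f) else 0 := by
  rw [if_pos (subset_univ f)]
  obtain ⟨a, b, c, d, e, hv⟩ : ∃ a b c d e, rankList f = [a, b, c, d, e] := by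
    have h := length_rankList f
    rw [hf] at h
    match rankList f, h with
    | [a, b, c, d, e], _ => exact ⟨a, b, c, d, e, rfl⟩
  have hr : rankWeight plus (rankList f) = weight plus (rankPay a b c d e) := by rw [hv]; rfl
  have hb : flushBonus plus (rankList f) =
      weight plus (flushPay a d e) - weight plus (rankPay a b c d e) := by rw [hv]; rfl
  by_cases h : IsFlush f
  · rw [handWeight, payout_of_isFlush hv h]
    have hst := strict_of_isFlush hv h
    obtain ⟨q, hq⟩ := h
    obtain ⟨x, hx⟩ : f.Nonempty := card_pos.1 (by omega)
    rw [sum_eq_single_of_mem q (mem_univ q), if_pos (subset_suitCards.2 hq), hr, hb,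
      Nat.add_sub_cancel' (weight_mono plus (rankPay_le_flushPay a b c d e hst) (flushPay_le a d e))]
    intro q' _ hne
    exact if_neg fun H => hne ((subset_suitCards.1 H x hx).symm.trans (hq x hx))
  · rw [handWeight, payout_of_not_isFlush hv h, hr, sum_eq_zero, add_zero]
    exact fun q _ => if_neg fun H => h ⟨q, subset_suitCards.1 H⟩

theorem containSum_handWeight (plus : Bool) {s : Finset Card} (hs : s.card ≤ 5) {v : List ℕ}
    (hv : v.Pairwise (· ≤ ·)) (hvs : (v : Multiset ℕ) = rankMultiset s) :
    containSum (handWeight plus) s ∅ = rankTable plus v +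
      (univ.filter fun q => s ⊆ suitCards q).card * flushTable plus v := by
  have hlen : v.length = s.card := by
    rw [← Multiset.coe_card, hvs, card_rankMultiset]
  have hk : s.card + (5 - s.card) = 5 := by omega
  rw [containSum_congr (fun f hf => handWeight_eq plus hf), containSum_add, containSum_sum,
    containSum_eq_table (q := 4) (by decide) hk (subset_univ s) hv hvs]
  have hS : ∀ q : Fin 4, ∀ r : Fin 13, ((suitCards q).filter fun c => c.1 = r).card = 1 := by
    decide
  have h (q : Fin 4) :
      containSum (fun f => if f ⊆ suitCards q then flushBonus plus (rankList f) else 0) s ∅ =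
        if s ⊆ suitCards q then flushTable plus v else 0 := by
    split_ifs with hq
    · rw [containSum_eq_table (q := 1) (hS q) hk hq hv hvs, flushTable, len_eq, hlen]
      rfl
    · exact sum_eq_zero fun f hf => if_neg fun hf' => hq ((mem_filter.1 hf).2.1.trans hf')
  rw [sum_congr rfl fun q _ => h q, ← sum_filter, sum_const, smul_eq_mul, rankTable, len_eq, hlen]
  rfl

end HandWeight

/-! ### Initial hands of a given pattern -/

section Lanes

/-- The strictly decreasing sequences of `j` numbers less than `n`. -/
def lanes : ℕ → ℕ → List (List ℕ)
  | _, 0 => [[]]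
  | 0, _ + 1 => []
  | n + 1, j + 1 => (lanes n j).map (n :: ·) ++ lanes n (j + 1)

theorem lanes_zero_right (n : ℕ) : lanes n 0 = [[]] := by cases n <;> rfl

theorem length_lanes (n j : ℕ) : (lanes n j).length = n.choose j := by
  induction n generalizing j with
  | zero => cases j <;> rfl
  | succ n ih =>
    cases j with
    | zero => simp [lanes]
    | succ j => simp [lanes, ih, Nat.choose_succ_succ]

theorem mem_lanes {n j : ℕ} {ρ : List ℕ} :
    ρ ∈ lanes n j ↔ ρ.length = j ∧ ρ.Pairwise (· > ·) ∧ ∀ r ∈ ρ, r < n := by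
  induction n generalizing j ρ with
  | zero =>
    cases j with
    | zero => cases ρ <;> simp [lanes]
    | succ j =>
      simp only [lanes, List.not_mem_nil, false_iff, not_and, not_forall]
      exact fun h _ => ⟨_, List.getElem_mem (n := 0) (by omega), by simp⟩
  | succ n ih =>
    cases j with
    | zero => cases ρ <;> simp [lanes]
    | succ j =>
      cases ρ with
      | nil => simp [lanes, ih]
      | cons r ρ =>
        simp only [lanes, List.mem_append, List.mem_map, ih, List.length_cons, List.pairwise_cons,
          List.forall_mem_cons, List.cons.injEq]
        constructor
        · rintro (⟨ρ', ⟨h1, h2, h3⟩, rfl, rfl⟩ | ⟨h1, ⟨h2, h3⟩, h4, h5⟩)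
          · exact ⟨by omega, ⟨h3, h2⟩, by omega, fun x hx => (h3 x hx).trans (by omega)⟩
          · exact ⟨h1, ⟨h2, h3⟩, by omega, fun x hx => (h5 x hx).trans (by omega)⟩
        · rintro ⟨h1, ⟨h2, h3⟩, h4, h5⟩
          rcases Nat.lt_succ_iff_lt_or_eq.1 h4 with h | rfl
          · exact Or.inr ⟨h1, ⟨h2, h3⟩, h, fun x hx => (h2 x hx).trans h⟩
          · exact Or.inl ⟨ρ, ⟨by omega, h3, h2⟩, rfl, rfl⟩

/-- The list, preceding `v`, with `c` copies of `r` for corresponding entries `c` and `r`. -/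
def spread : List ℕ → List ℕ → List ℕ → List ℕ
  | c :: cs, r :: ρ, v => spread cs ρ (List.replicate c r ++ v)
  | _, _, v => v

theorem consK_eq (c x : ℕ) (v : List ℕ) (k : List ℕ → ℕ) :
    consK c x v k = k (List.replicate c x ++ v) := by
  induction c generalizing v with
  | zero => rfl
  | succ c ih =>
    change consK c x (x :: v) k = _
    rw [ih, List.replicate_succ', List.append_assoc]
    rfl

theorem gather_eq (T : List ℕ → ℕ) (n : ℕ) (cs v : List ℕ) :
    gather T n cs v = pack (lanes n cs.length) fun ρ => T (spread cs ρ v) := by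
  induction n generalizing cs v with
  | zero =>
    cases cs with
    | nil => simp [lanes, pack, spread]; rfl
    | cons c cs => simp [lanes]; rfl
  | succ n ih =>
    cases cs with
    | nil => simp [lanes, pack, spread]; rfl
    | cons c cs =>
      change consK c n v (gather T n cs) + gather T n (c :: cs) v <<< (96 * binom n (len cs)) = _
      rw [consK_eq, ih, ih, List.length_cons, lanes, pack_append, pack_map, List.length_map,
        length_lanes, binom_eq, len_eq, Nat.shiftLeft_eq, mul_comm (pack _ _)]
      rfl

theorem incK_eq {i : ℕ} {cs : List ℕ} (h : i < cs.length) (k : List ℕ → ℕ) :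
    incK i cs k = k (cs.modify i (· + 1)) := by
  induction cs generalizing i k with
  | nil => simp at h
  | cons c cs ih =>
    cases i with
    | zero => rfl
    | succ i =>
      change incK i cs (fun cs' => k (c :: cs')) = _
      rw [ih (by simpa using h)]
      rfl

/-- The list of length `j` whose entry with index `i` is the number of entries of `l` with first
component `i`. -/
def counts (j : ℕ) (l : List (ℕ × ℕ)) : List ℕ :=
  l.foldr (fun p cs => cs.modify p.1 (· + 1)) (List.replicate j 0)

theorem length_counts (j : ℕ) (l : List (ℕ × ℕ)) : (counts j l).length = j := by
  induction l with
  | nil => simp [counts]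
  | cons p l ih => simpa [counts] using ih

theorem countsK_eq {j : ℕ} {l : List (ℕ × ℕ)} (h : ∀ p ∈ l, p.1 < j) (k : List ℕ → ℕ) :
    countsK j l k = k (counts j l) := by
  induction l generalizing k with
  | nil =>
    change consK j 0 [] k = _
    rw [consK_eq, List.append_nil]
    rfl
  | cons p l ih =>
    rw [List.forall_mem_cons] at h
    change countsK j l (fun cs => incK p.1 cs k) = _
    rw [ih h.2, incK_eq (by rw [length_counts]; exact h.1)]
    rfl

theorem coe_spread (cs ρ v : List ℕ) :
    (spread cs ρ v : Multiset ℕ) = (spread cs ρ [] : Multiset ℕ) + v := by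
  induction cs generalizing ρ v with
  | nil => simp [spread]
  | cons c cs ih =>
    cases ρ with
    | nil => simp [spread]
    | cons r ρ =>
      rw [spread, spread, ih, ih (v := _ ++ []), add_assoc]
      simp

theorem coe_spread_modify {cs ρ : List ℕ} {i : ℕ} (h : cs.length = ρ.length) (hi : i < ρ.length) :
    (spread (cs.modify i (· + 1)) ρ [] : Multiset ℕ) =
      ρ.getD i 0 ::ₘ (spread cs ρ [] : Multiset ℕ) := by
  induction cs generalizing ρ i with
  | nil => simp at h; omega
  | cons c cs ih =>
    cases ρ with
    | nil => simp at h
    | cons r ρ =>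
      cases i with
      | zero =>
        simp only [List.modify_zero_cons, spread]
        rw [coe_spread, coe_spread (v := List.replicate c r ++ [])]
        simp [List.replicate_succ]
      | succ i =>
        simp only [List.modify_succ_cons, spread, List.getD_cons_succ]
        rw [coe_spread, coe_spread (v := List.replicate c r ++ []),
          ih (by simpa using h) (by simpa using hi)]
        simp

theorem coe_spread_counts {ρ : List ℕ} {l : List (ℕ × ℕ)} (h : ∀ p ∈ l, p.1 < ρ.length) :
    (spread (counts ρ.length l) ρ [] : Multiset ℕ) = l.map fun p => ρ.getD p.1 0 := by
  induction l with
  | nil =>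
    induction ρ with
    | nil => rfl
    | cons r ρ ih => simpa [counts, List.replicate_succ, spread] using ih
  | cons p l ih =>
    rw [List.forall_mem_cons] at h
    change (spread ((counts ρ.length l).modify p.1 _) ρ [] : Multiset ℕ) = _
    rw [coe_spread_modify (length_counts _ _) h.1, ih h.2]
    rfl

theorem pairwise_spread {cs ρ v : List ℕ} (hρ : ρ.Pairwise (· > ·)) (hv : v.Pairwise (· ≤ ·))
    (h : ∀ r ∈ ρ, ∀ x ∈ v, r ≤ x) : (spread cs ρ v).Pairwise (· ≤ ·) := by
  induction cs generalizing ρ v with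
  | nil => simpa [spread]
  | cons c cs ih =>
    cases ρ with
    | nil => simpa [spread]
    | cons r ρ =>
      rw [List.pairwise_cons] at hρ
      rw [List.forall_mem_cons] at h
      rw [spread]
      refine ih hρ.2 ?_ ?_
      · rw [List.pairwise_append]
        refine ⟨List.pairwise_replicate.2 (Or.inr le_rfl), hv, fun a ha x hx => ?_⟩
        rw [List.eq_of_mem_replicate ha]
        exact h.1 x hx
      · intro r' hr' x hx
        rcases List.mem_append.1 hx with hx | hx
        · rw [List.eq_of_mem_replicate hx]
          exact (hρ.1 r' hr').le
        · exact h.2 r' hr' x hx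

/-- The card coded by `p` if `ρ` lists the denominations. -/
def cardOf (ρ : List ℕ) (p : ℕ × ℕ) : Card := (Fin.ofNat 13 (ρ.getD p.1 0), Fin.ofNat 4 p.2)

/-- The set of cards coded by `l`. -/
def cardsOf (ρ : List ℕ) (l : List (ℕ × ℕ)) : Finset Card := (l.map (cardOf ρ)).toFinset

/-- `l` codes distinct cards of `j` denominations. -/
structure IsCode (j : ℕ) (l : List (ℕ × ℕ)) : Prop where
  nodup : l.Nodup
  lt : ∀ p ∈ l, p.1 < j ∧ p.2 < 4

theorem IsCode.sublist {j : ℕ} {l t : List (ℕ × ℕ)} (h : IsCode j l) (ht : t.Sublist l) :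
    IsCode j t :=
  ⟨h.nodup.sublist ht, fun p hp => h.lt p (ht.subset hp)⟩

theorem getD_inj_of_mem_lanes {n j : ℕ} {ρ : List ℕ} (hρ : ρ ∈ lanes n j) {a b : ℕ} (ha : a < j)
    (hb : b < j) (h : ρ.getD a 0 = ρ.getD b 0) : a = b := by
  obtain ⟨rfl, h2, -⟩ := mem_lanes.1 hρ
  rw [List.getD_eq_getElem _ _ ha, List.getD_eq_getElem _ _ hb] at h
  exact (List.Nodup.getElem_inj_iff (h2.imp fun h => h.ne')).1 h

theorem getD_lt_of_mem_lanes {n j : ℕ} {ρ : List ℕ} (hρ : ρ ∈ lanes n j) {a : ℕ} (ha : a < j) :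
    ρ.getD a 0 < n := by
  obtain ⟨rfl, -, h3⟩ := mem_lanes.1 hρ
  rw [List.getD_eq_getElem _ _ ha]
  exact h3 _ (List.getElem_mem _)

theorem IsCode.nodup_map {j : ℕ} {l : List (ℕ × ℕ)} (h : IsCode j l) {ρ : List ℕ}
    (hρ : ρ ∈ lanes 13 j) : (l.map (cardOf ρ)).Nodup := by
  refine List.Nodup.map_on (fun p hp q hq hpq => ?_) h.nodup
  obtain ⟨hp1, hp2⟩ := h.lt p hp
  obtain ⟨hq1, hq2⟩ := h.lt q hq
  simp only [cardOf, Prod.mk.injEq, Fin.ext_iff, Fin.val_ofNat,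
    Nat.mod_eq_of_lt (getD_lt_of_mem_lanes hρ hp1), Nat.mod_eq_of_lt (getD_lt_of_mem_lanes hρ hq1),
    Nat.mod_eq_of_lt hp2, Nat.mod_eq_of_lt hq2] at hpq
  exact Prod.ext (getD_inj_of_mem_lanes hρ hp1 hq1 hpq.1) hpq.2

theorem IsCode.rankMultiset_cardsOf {j : ℕ} {l : List (ℕ × ℕ)} (h : IsCode j l) {ρ : List ℕ}
    (hρ : ρ ∈ lanes 13 j) : rankMultiset (cardsOf ρ l) = l.map fun p => ρ.getD p.1 0 := by
  rw [rankMultiset, cardsOf, List.toFinset_val, (h.nodup_map hρ).dedup, Multiset.map_coe,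
    List.map_map]
  congr 1
  refine List.map_congr_left fun p hp => ?_
  exact Nat.mod_eq_of_lt (getD_lt_of_mem_lanes hρ (h.lt p hp).1)

theorem IsCode.card_cardsOf {j : ℕ} {l : List (ℕ × ℕ)} (h : IsCode j l) {ρ : List ℕ}
    (hρ : ρ ∈ lanes 13 j) : (cardsOf ρ l).card = l.length := by
  rw [cardsOf, List.toFinset_card_of_nodup (h.nodup_map hρ), List.length_map]

theorem commonSuit_spec {l : List (ℕ × ℕ)} (h : ∀ p ∈ l, p.2 < 4) :
    (commonSuit l = 4 ∧ l = []) ∨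
      (commonSuit l < 4 ∧ l ≠ [] ∧ ∀ p ∈ l, p.2 = commonSuit l) ∨
        (commonSuit l = 5 ∧ ∀ q, ∃ p ∈ l, p.2 ≠ q) := by
  induction l with
  | nil => exact Or.inl ⟨rfl, rfl⟩
  | cons p l ih =>
    rw [List.forall_mem_cons] at h
    have hrec : commonSuit (p :: l) = if commonSuit l = 4 then p.2 else
        if commonSuit l = p.2 then commonSuit l else 5 := by
      change sel (Nat.beq (commonSuit l) 4) p.2
        (sel (Nat.beq (commonSuit l) p.2) (commonSuit l) 5) = _
      simp only [sel_eq, Nat.beq_eq]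
    right
    rcases ih h.2 with ⟨h1, rfl⟩ | ⟨h1, h2, h3⟩ | ⟨h1, h2⟩
    · rw [hrec, if_pos h1]
      exact Or.inl ⟨h.1, by simp, by simp⟩
    · by_cases hp : commonSuit l = p.2
      · rw [hrec, if_neg h1.ne, if_pos hp]
        exact Or.inl ⟨h1, by simp, by simpa [hp] using h3⟩
      · rw [hrec, if_neg h1.ne, if_neg hp]
        refine Or.inr ⟨rfl, fun q => ?_⟩
        by_cases hq : p.2 = q
        · obtain ⟨p', hp'⟩ := List.exists_mem_of_ne_nil l h2
          exact ⟨p', by simp [hp'], by rw [h3 p' hp', ← hq]; exact hp⟩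
        · exact ⟨p, by simp, hq⟩
    · rw [hrec, if_neg (by omega), if_neg (by omega)]
      refine Or.inr ⟨rfl, fun q => ?_⟩
      obtain ⟨p', hp', hq⟩ := h2 q
      exact ⟨p', by simp [hp'], hq⟩

open Finset in
theorem IsCode.card_suits {j : ℕ} {l : List (ℕ × ℕ)} (h : IsCode j l) (ρ : List ℕ) (x : ℕ) :
    (univ.filter fun q => cardsOf ρ l ⊆ suitCards q).card * x =
      if commonSuit l = 5 then 0 else (if commonSuit l = 4 then 4 else 1) * x := by
  have h4 : ∀ p ∈ l, p.2 < 4 := fun p hp => (h.lt p hp).2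
  have hsub (q : Fin 4) : cardsOf ρ l ⊆ suitCards q ↔ ∀ p ∈ l, p.2 = q := by
    rw [subset_suitCards, cardsOf]
    simp only [List.mem_toFinset, List.mem_map, forall_exists_index, and_imp,
      forall_apply_eq_imp_iff₂]
    refine forall₂_congr fun p hp => ?_
    simp [cardOf, Fin.ext_iff, Nat.mod_eq_of_lt (h4 p hp)]
  simp only [hsub]
  rcases commonSuit_spec h4 with ⟨h1, rfl⟩ | ⟨h1, h2, h3⟩ | ⟨h1, h2⟩
  -- With no card held, each of the four suits can still give a flush.
  · simp [h1]
  · rw [if_neg (by omega), if_neg (by omega)]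
    congr 1
    rw [card_eq_one]
    refine ⟨⟨commonSuit l, h1⟩, ?_⟩
    ext q
    simp only [mem_filter, mem_univ, true_and, mem_singleton, Fin.ext_iff]
    constructor
    · intro hq
      obtain ⟨p, hp⟩ := List.exists_mem_of_ne_nil l h2
      rw [← hq p hp, h3 p hp]
    · intro hq p hp
      rw [hq, h3 p hp]
  · rw [if_pos h1, filter_false_of_mem, card_empty, zero_mul]
    intro q _ hq
    obtain ⟨p, hp, hpq⟩ := h2 q
    exact hpq (hq p hp)

theorem IsCode.containing_eq (plus : Bool) {j : ℕ} {l : List (ℕ × ℕ)} (h : IsCode j l)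
    (hl : l.length ≤ 5) :
    containing plus j l =
      pack (lanes 13 j) fun ρ => containSum (handWeight plus) (cardsOf ρ l) ∅ := by
  have h1 : containing plus j l = pack (lanes 13 j) (fun ρ =>
      rankTable plus (spread (counts j l) ρ []) + if commonSuit l = 5 then 0 else
        (if commonSuit l = 4 then 4 else 1) * flushTable plus (spread (counts j l) ρ [])) := by
    rw [containing, countsK_eq fun p hp => (h.lt p hp).1]
    simp only [sel_eq, Nat.beq_eq, gather_eq, length_counts]
    rw [← pack_add]
    congr 1
    split_ifs
    · exact (pack_zero _).symm
    · exact pack_mul _ _ _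
    · exact pack_mul _ _ _
  rw [h1]
  refine pack_congr fun ρ hρ => ?_
  have hρ' := mem_lanes.1 hρ
  rw [← h.card_suits ρ]
  refine (containSum_handWeight plus ((h.card_cardsOf hρ).trans_le hl) ?_ ?_).symm
  · exact pairwise_spread hρ'.2.1 List.Pairwise.nil (by simp)
  · rw [h.rankMultiset_cardsOf hρ]
    obtain ⟨rfl, -⟩ := hρ'
    exact coe_spread_counts fun p hp => (h.lt p hp).1

/-- `G t` packs the sums for hands that contain `s` and the cards `t` and avoid `D`. Holding the
next card `p` replaces `G t` by `G (p :: t)`; discarding it replaces `G t` by `G t - G (p :: t)`, by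
`containSum_insert`. The bound `2 ^ 53 * 7669695 < 2 ^ 95` keeps the comparison flags free. -/
theorem best_eq {ι : Type} {L : List ι} {m : ℕ} (hm : L.length = m) (w : Finset Card → ℕ)
    (hw : ∀ f, w f ≤ 2 ^ 53) (c : ι → ℕ × ℕ → Card) (h : ι → Finset Card)
    (hh : ∀ ρ ∈ L, (h ρ).card = 5) {l : List (ℕ × ℕ)} {G : List (ℕ × ℕ) → ℕ} {k : ℕ}
    {s D : ι → Finset Card} (H : ∀ ρ ∈ L, Splits (h ρ) (s ρ) (D ρ) (l.map (c ρ)))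
    (hk : ∀ ρ ∈ L, (s ρ).card = k)
    (hG : ∀ t, t.Sublist l →
      G t = pack L fun ρ => containSum w (s ρ ∪ (t.map (c ρ)).toFinset) (D ρ)) :
    best m l G k = pack L fun ρ => holdMax w (l.map (c ρ)) k (s ρ) (D ρ) := by
  induction l generalizing G k s D with
  | nil =>
    change scale k * G [] = _
    rw [hG [] (List.Sublist.refl _), pack_mul]
    simp [holdMax]
  | cons p l ih =>
    have H' : ∀ ρ ∈ L, _ := fun ρ hρ => (H ρ hρ).cons_hold
    have H1 : ∀ ρ ∈ L, Splits (h ρ) (insert (c ρ p) (s ρ)) (D ρ) (l.map (c ρ)) :=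
      fun ρ hρ => (H' ρ hρ).2.2
    have H2 : ∀ ρ ∈ L, Splits (h ρ) (s ρ) (insert (c ρ p) (D ρ)) (l.map (c ρ)) :=
      fun ρ hρ => (H ρ hρ).cons_discard
    have hk1 : ∀ ρ ∈ L, (insert (c ρ p) (s ρ)).card = k + 1 := fun ρ hρ => by
      rw [Finset.card_insert_of_notMem (H' ρ hρ).1, hk ρ hρ]
    change vmax m (best m l (fun t => G (p :: t)) (k + 1))
      (best m l (fun t => G t - G (p :: t)) k) = _
    rw [ih H1 hk1, ih H2 hk, vmax_eq hm]
    · rfl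
    · intro ρ hρ
      have := holdMax_le hw (hh ρ hρ) (H1 ρ hρ)
      rw [hk1 ρ hρ] at this
      exact this.trans_lt (by norm_num)
    · intro ρ hρ
      have := holdMax_le hw (hh ρ hρ) (H2 ρ hρ)
      rw [hk ρ hρ] at this
      exact this.trans_lt (by norm_num)
    · intro t ht
      have hi (ρ) := containSum_insert w (c ρ p) (s ρ ∪ (t.map (c ρ)).toFinset) (D ρ)
      rw [hG t (ht.cons p), hG (p :: t) (ht.cons_cons p), pack_sub]
      · refine pack_congr fun ρ _ => ?_
        rw [hi, List.map_cons, List.toFinset_cons, Finset.union_insert, Nat.add_sub_cancel_left]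
      · intro ρ _
        rw [hi, List.map_cons, List.toFinset_cons, Finset.union_insert]
        exact Nat.le_add_right _ _
    · intro t ht
      rw [hG (p :: t) (ht.cons_cons p)]
      refine pack_congr fun ρ _ => ?_
      rw [List.map_cons, List.toFinset_cons, Finset.union_insert, Finset.insert_union]

theorem IsCode.values_eq (plus : Bool) {j : ℕ} {l : List (ℕ × ℕ)} (h : IsCode j l)
    (hl : l.length = 5) :
    values plus j l = pack (lanes 13 j) fun ρ => maxValue (handWeight plus) (cardsOf ρ l) := by
  have hb := best_eq (m := binom 13 j) (L := lanes 13 j) (by rw [length_lanes, binom_eq])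
    (handWeight plus) (handWeight_le plus) cardOf (fun ρ => cardsOf ρ l)
    (fun ρ hρ => (h.card_cardsOf hρ).trans hl) (l := l) (G := containing plus j) (k := 0)
    (s := fun _ => ∅) (D := fun _ => ∅) (fun ρ hρ => splits_toFinset (h.nodup_map hρ))
    (fun _ _ => Finset.card_empty) (fun t ht => by
      simp only [Finset.empty_union]
      exact (h.sublist ht).containing_eq plus (ht.length_le.trans hl.le))
  rw [values, hb]
  exact pack_congr fun ρ hρ => holdMax_eq_maxValue _ (h.nodup_map hρ)

end Lanes

/-! ### Permutations of the suits -/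

section Symmetry

open Finset

/-- The set that results from `h` by a permutation of the suits. -/
def permute (g : Equiv.Perm (Fin 4)) (h : Finset Card) : Finset Card :=
  h.image fun c => (c.1, g c.2)

variable (g : Equiv.Perm (Fin 4))

theorem mem_permute {h : Finset Card} {c : Card} : c ∈ permute g h ↔ (c.1, g.symm c.2) ∈ h := by
  simp only [permute, mem_image, Prod.ext_iff]
  constructor
  · rintro ⟨x, hx, h1, h2⟩
    rwa [← h1, ← h2, Equiv.symm_apply_apply]
  · exact fun hc => ⟨_, hc, by simp⟩

theorem permute_symm_permute (h : Finset Card) : permute g.symm (permute g h) = h := by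
  ext c
  simp [mem_permute]

theorem permute_permute_symm (h : Finset Card) : permute g (permute g.symm h) = h := by
  ext c
  simp [mem_permute]

theorem card_permute (h : Finset Card) : (permute g h).card = h.card :=
  card_image_of_injective _ fun c c' hc => by simpa [Prod.ext_iff] using hc

theorem permute_subset_permute {s t : Finset Card} : permute g s ⊆ permute g t ↔ s ⊆ t := by
  refine ⟨fun h => ?_, image_subset_image⟩
  rw [← permute_symm_permute g s, ← permute_symm_permute g t]
  exact image_subset_image h

theorem permute_sdiff (s t : Finset Card) : permute g (s \ t) = permute g s \ permute g t := by
  ext c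
  simp [mem_permute]

theorem permute_union (s t : Finset Card) : permute g (s ∪ t) = permute g s ∪ permute g t :=
  image_union _ _

theorem disjoint_permute {s t : Finset Card} :
    Disjoint (permute g s) (permute g t) ↔ Disjoint s t := by
  rw [permute, permute, disjoint_image fun c c' hc => by simpa [Prod.ext_iff] using hc]

theorem ranks_permute (h : Finset Card) : ranks (permute g h) = ranks h := by
  rw [ranks, ranks, permute, image_image]
  rfl

theorem rankCount_permute (h : Finset Card) (r : Fin 13) :
    rankCount (permute g h) r = rankCount h r := by
  rw [rankCount, rankCount, ← card_permute g (h.filter _)]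
  congr 1
  ext c
  simp [mem_permute]

theorem isFlush_permute (h : Finset Card) : IsFlush (permute g h) ↔ IsFlush h := by
  rw [IsFlush, IsFlush, ← g.exists_congr_right]
  refine exists_congr fun s => ?_
  rw [permute, forall_mem_image]
  simp only [EmbeddingLike.apply_eq_iff_eq]

theorem payout_permute (h : Finset Card) : payout (permute g h) = payout h := by
  simp only [payout, isFlush_permute, IsStraight, ranks_permute, rankCount_permute]

variable {w : Finset Card → ℕ} {g}

theorem containSum_permute (hw : ∀ f, w (permute g f) = w f) (s D : Finset Card) :
    containSum w (permute g s) (permute g D) = containSum w s D := by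
  symm
  refine sum_nbij' (permute g) (permute g.symm) ?_ ?_ (fun f _ => permute_symm_permute g f)
    (fun f _ => permute_permute_symm g f) fun f _ => (hw f).symm
  · intro f hf
    simpa [card_permute, permute_subset_permute, disjoint_permute] using hf
  · intro f hf
    rw [← permute_permute_symm g f] at hf
    simpa only [mem_filter, mem_powersetCard, subset_univ, true_and, card_permute,
      permute_subset_permute, disjoint_permute] using hf

theorem value_permute (hw : ∀ f, w (permute g f) = w f) (h s : Finset Card) :
    value w (permute g h) (permute g s) = value w h s := by
  rw [value, card_permute, ← permute_sdiff, containSum_permute hw, value]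

/-- A permutation carries holds of `h` to holds of its image with the same value; applying this to
the inverse gives the other inequality. -/
theorem maxValue_permute (hw : ∀ g f, w (permute g f) = w f) (g : Equiv.Perm (Fin 4))
    (h : Finset Card) : maxValue w (permute g h) = maxValue w h := by
  have key (g : Equiv.Perm (Fin 4)) (h : Finset Card) :
      maxValue w h ≤ maxValue w (permute g h) := by
    refine Finset.sup_le fun s hs => ?_
    rw [← value_permute (hw g)]
    exact le_sup (f := value w (permute g h))
      (mem_powerset.2 ((permute_subset_permute g).2 (mem_powerset.1 hs)))
  refine le_antisymm ?_ (key g h)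
  conv_rhs => rw [← permute_symm_permute g h]
  exact key g.symm _

theorem handWeight_permute (plus : Bool) (g : Equiv.Perm (Fin 4)) (f : Finset Card) :
    handWeight plus (permute g f) = handWeight plus f := by
  rw [handWeight, payout_permute, handWeight]

/-- The sum of `Φ τ` over the lists `τ` of sets of suits with sizes `κ`. -/
def suitSum : List ℕ → (List (Finset (Fin 4)) → ℕ) → ℕ
  | [], Φ => Φ []
  | m :: κ, Φ => ∑ S ∈ powersetCard m univ, suitSum κ fun τ => Φ (S :: τ)

theorem suitSum_map (g : Equiv.Perm (Fin 4)) (κ : List ℕ) (Φ : List (Finset (Fin 4)) → ℕ) :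
    suitSum κ (fun τ => Φ (τ.map fun S => S.image g)) = suitSum κ Φ := by
  induction κ generalizing Φ with
  | nil => rfl
  | cons m κ ih =>
    simp only [suitSum, List.map_cons]
    rw [sum_congr rfl fun S _ => ih fun τ => Φ (S.image g :: τ)]
    refine sum_nbij' (fun S => S.image g) (fun S => S.image g.symm) ?_ ?_ ?_ ?_ fun _ _ => rfl
    · intro S hS
      simpa [mem_powersetCard, card_image_of_injective _ g.injective] using hS
    · intro S hS
      simpa [mem_powersetCard, card_image_of_injective _ g.symm.injective] using hS
    · intro S _
      simp [image_image]
    · intro S _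
      simp [image_image]

theorem list_sum_flatMap {ι : Type} (L : List ι) (f : ι → List ℕ) :
    (L.flatMap f).sum = (L.map fun x => (f x).sum).sum := by
  induction L with
  | nil => rfl
  | cons x L ih => simp only [List.flatMap_cons, List.sum_append, List.map_cons, List.sum_cons, ih]

theorem sum_list_sum {ι κ : Type} (s : Finset ι) (L : List κ) (f : ι → κ → ℕ) :
    ∑ i ∈ s, (L.map (f i)).sum = (L.map fun x => ∑ i ∈ s, f i x).sum := by
  induction L with
  | nil => simp
  | cons x L ih => simp only [List.map_cons, List.sum_cons, sum_add_distrib, ih]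

/-- The set of suits coded by a list. -/
def suitSet (S : List ℕ) : Finset (Fin 4) := (S.map (Fin.ofNat 4)).toFinset

/-- The sets of suits equivalent to `S` under permutations that fix the suits less than `k`. -/
def suitOrbit (k : ℕ) (S : Finset (Fin 4)) : Finset (Finset (Fin 4)) :=
  (univ.filter fun g : Equiv.Perm (Fin 4) => ∀ q : Fin 4, q.val < k → g q = q).image
    fun g : Equiv.Perm (Fin 4) => S.image g

/-- The multiplicities are the orbit sizes, and the orbits partition the `m`-element sets: each such
set lies in exactly one listed orbit. -/
theorem suitSteps_spec : ∀ k ∈ range 5, ∀ m ∈ [1, 2, 3, 4],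
    (∀ s ∈ suitSteps k m, (suitOrbit k (suitSet s.2.1)).card = s.1 ∧ k ≤ s.2.2 ∧ s.2.2 < 5 ∧
      ∀ q ∈ suitSet s.2.1, q.val < s.2.2) ∧
    ∀ S : Finset (Fin 4), ((suitSteps k m).map fun s =>
      if S ∈ suitOrbit k (suitSet s.2.1) then 1 else 0).sum = if S.card = m then 1 else 0 := by
  decide +kernel

theorem sum_suitSteps {k m : ℕ} (hk : k < 5) (hm : m ∈ [1, 2, 3, 4]) {Θ : Finset (Fin 4) → ℕ}
    (hΘ : ∀ g : Equiv.Perm (Fin 4), (∀ q : Fin 4, q.val < k → g q = q) →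
      ∀ S, Θ (S.image g) = Θ S) :
    ∑ S ∈ powersetCard m univ, Θ S =
      ((suitSteps k m).map fun s => s.1 * Θ (suitSet s.2.1)).sum := by
  obtain ⟨h1, h2⟩ := suitSteps_spec k (mem_range.2 hk) m hm
  have h (s) (hs : s ∈ suitSteps k m) : s.1 * Θ (suitSet s.2.1) =
      ∑ S, (if S ∈ suitOrbit k (suitSet s.2.1) then 1 else 0) * Θ S := by
    simp only [ite_mul, one_mul, zero_mul]
    rw [← sum_filter, filter_mem_eq_inter, univ_inter, ← (h1 s hs).1, ← smul_eq_mul, ← sum_const]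
    refine sum_congr rfl fun S hS => ?_
    obtain ⟨g, hg, rfl⟩ := mem_image.1 hS
    exact (hΘ g (mem_filter.1 hg).2 _).symm
  rw [List.map_congr_left h, ← sum_list_sum]
  simp only [List.sum_map_mul_right, h2]
  simp only [ite_mul, one_mul, zero_mul]
  rw [← sum_filter]
  refine sum_congr ?_ fun _ _ => rfl
  ext S
  simp [mem_powersetCard]

/-- Representatives, with multiplicities, of the lists of sets of suits with sizes `κ`, up to
permutations that fix the suits less than `k`. -/
def suitReps : List ℕ → ℕ → List (ℕ × List (List ℕ))
  | [], _ => [(1, [])]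
  | m :: κ, k => (suitSteps k m).flatMap fun s =>
      (suitReps κ s.2.2).map fun p => (s.1 * p.1, s.2.1 :: p.2)

/-- Sets of suits are normalized one after another. Once a representative is chosen, only
permutations fixing the suits below the new bound are used; they fix the representative pointwise,
so the remaining sum is still symmetric under them. -/
theorem suitSum_eq {κ : List ℕ} (hκ : ∀ m ∈ κ, m ∈ [1, 2, 3, 4]) {k : ℕ} (hk : k < 5)
    {Φ : List (Finset (Fin 4)) → ℕ}
    (hΦ : ∀ g : Equiv.Perm (Fin 4), (∀ q : Fin 4, q.val < k → g q = q) →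
      ∀ τ, Φ (τ.map fun S => S.image g) = Φ τ) :
    suitSum κ Φ = ((suitReps κ k).map fun p => p.1 * Φ (p.2.map suitSet)).sum := by
  induction κ generalizing k Φ with
  | nil => simp [suitSum, suitReps]
  | cons m κ ih =>
    rw [List.forall_mem_cons] at hκ
    rw [suitSum, sum_suitSteps hk hκ.1, suitReps, List.map_flatMap, list_sum_flatMap]
    · refine congrArg List.sum (List.map_congr_left fun s hs => ?_)
      obtain ⟨-, h2, h3, h4⟩ := (suitSteps_spec k (mem_range.2 hk) m hκ.1).1 s hs
      rw [ih hκ.2 h3, ← List.sum_map_mul_left, List.map_map]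
      · simp only [Function.comp_def, List.map_cons, mul_assoc]
      · intro g hg τ
        rw [← hΦ g (fun q hq => hg q (hq.trans_le h2)) (suitSet s.2.1 :: τ), List.map_cons]
        congr 2
        have : Set.EqOn g id (suitSet s.2.1) := fun q hq => hg q (h4 q hq)
        rw [image_congr this, image_id]
    · intro g hg S
      rw [← suitSum_map g]
      simp only [← hΦ g hg (S :: _), List.map_cons]

/-- The code of a list of sets of suits. -/
def encode : ℕ → List (List ℕ) → List (ℕ × ℕ)
  | _, [] => []
  | i, S :: τ => S.map (fun q => (i, q)) ++ encode (i + 1) τ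

theorem suitClasses_eq (κ : List ℕ) (i k : ℕ) :
    suitClasses κ i k = (suitReps κ k).map fun p => (p.1, encode i p.2) := by
  induction κ generalizing i k with
  | nil => rfl
  | cons m κ ih =>
    rw [suitClasses, suitReps, List.map_flatMap]
    simp only [ih, List.map_map]
    rfl

theorem length_of_mem_suitReps {κ : List ℕ} {k : ℕ} {p : ℕ × List (List ℕ)}
    (hp : p ∈ suitReps κ k) : p.2.length = κ.length := by
  induction κ generalizing k p with
  | nil => simp [suitReps] at hp; simp [hp]
  | cons m κ ih =>
    simp only [suitReps, List.mem_flatMap, List.mem_map] at hp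
    obtain ⟨s, -, p', hp', rfl⟩ := hp
    simp [ih hp']

/-- The cards of denomination `r` with suits in `S`. -/
def block (r : ℕ) (S : Finset (Fin 4)) : Finset Card := S.image fun q => (Fin.ofNat 13 r, q)

/-- The cards with denominations in a list and suits in the corresponding sets. -/
def build : List ℕ → List (Finset (Fin 4)) → Finset Card
  | r :: ρ, S :: τ => block r S ∪ build ρ τ
  | _, _ => ∅

theorem permute_build (g : Equiv.Perm (Fin 4)) (ρ : List ℕ) (τ : List (Finset (Fin 4))) :
    permute g (build ρ τ) = build ρ (τ.map fun S => S.image g) := by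
  induction ρ generalizing τ with
  | nil => simp [build, permute]
  | cons r ρ ih =>
    cases τ with
    | nil => simp [build, permute]
    | cons S τ =>
      rw [build, permute_union, ih, List.map_cons, build, permute, block, block, image_image,
        image_image]
      rfl

theorem cardsOf_encode (ρ' : List ℕ) {ρ : List ℕ} {τ : List (List ℕ)} (h : τ.length = ρ.length) :
    cardsOf (ρ' ++ ρ) (encode ρ'.length τ) = build ρ (τ.map suitSet) := by
  induction τ generalizing ρ' ρ with
  | nil =>
    cases ρ with
    | nil => rfl
    | cons r ρ => simp at h
  | cons S τ ih =>
    cases ρ with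
    | nil => simp at h
    | cons r ρ =>
      have := ih (ρ' ++ [r]) (ρ := ρ) (by simpa using h)
      rw [List.append_assoc, List.length_append] at this
      rw [List.map_cons, build, ← this, encode, cardsOf, List.map_append, List.toFinset_append]
      congr 1
      ext c
      simp [block, suitSet, cardOf, eq_comm]

end Symmetry

/-! ### Enumeration of the hands -/

section Enumeration

open Finset

/-- The cards of denomination less than `N`. -/
def deck (N : ℕ) : Finset Card := univ.filter fun c => c.1.val < N

theorem mem_deck {N : ℕ} {c : Card} : c ∈ deck N ↔ c.1.val < N := by simp [deck]

theorem mem_block {N : ℕ} (hN : N < 13) {S : Finset (Fin 4)} {c : Card} :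
    c ∈ block N S ↔ c.1.val = N ∧ c.2 ∈ S := by
  simp only [block, mem_image, Prod.ext_iff, Fin.ext_iff, Fin.val_ofNat, Nat.mod_eq_of_lt hN]
  constructor
  · rintro ⟨q, hq, h1, h2⟩
    exact ⟨h1.symm, Fin.ext h2 ▸ hq⟩
  · exact fun h => ⟨c.2, h.2, h.1.symm, rfl⟩

theorem card_block (N : ℕ) (S : Finset (Fin 4)) : (block N S).card = S.card :=
  card_image_of_injective _ fun q q' h => by simpa using h

theorem disjoint_block {N : ℕ} (hN : N < 13) {S : Finset (Fin 4)} {h : Finset Card}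
    (hh : h ⊆ deck N) : Disjoint (block N S) h :=
  disjoint_left.2 fun c hc hc' => by
    have h1 := (mem_block hN).1 hc
    have h2 := mem_deck.1 (hh hc')
    omega

/-- A set of cards splits uniquely into its cards of the top denomination `N`, given by their suits,
and the rest. -/
theorem sum_powerset_deck_succ {N : ℕ} (hN : N < 13) (Φ : Finset Card → ℕ) :
    ∑ h ∈ (deck (N + 1)).powerset, Φ h =
      ∑ S : Finset (Fin 4), ∑ h ∈ (deck N).powerset, Φ (block N S ∪ h) := by
  rw [← sum_product']
  symm
  refine sum_nbij' (fun p => block N p.1 ∪ p.2)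
    (fun h => (univ.filter fun q => (Fin.ofNat 13 N, q) ∈ h, h.filter fun c => c.1.val < N))
    ?_ ?_ ?_ ?_ fun _ _ => rfl
  · intro p hp
    simp only [mem_product, mem_univ, true_and, mem_powerset] at hp
    rw [mem_powerset]
    refine union_subset (fun c hc => ?_) fun c hc => ?_
    · have := (mem_block hN).1 hc
      exact mem_deck.2 (by omega)
    · have := mem_deck.1 (hp hc)
      exact mem_deck.2 (by omega)
  · intro h _
    simp only [mem_product, mem_univ, true_and, mem_powerset]
    exact fun c hc => mem_deck.2 (mem_filter.1 hc).2
  · rintro ⟨S, h⟩ hp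
    simp only [mem_product, mem_univ, true_and, mem_powerset] at hp
    refine Prod.ext ?_ ?_
    · ext q
      have : ((Fin.ofNat 13 N, q) : Card) ∉ h := fun H => by
        have := mem_deck.1 (hp H)
        simp [Nat.mod_eq_of_lt hN] at this
      simp only [mem_filter, mem_univ, true_and, mem_union, mem_block hN, this, or_false,
        Fin.val_ofNat, Nat.mod_eq_of_lt hN]
    · ext c
      simp only [mem_filter, mem_union, mem_block hN]
      constructor
      · rintro ⟨h1 | h1, h2⟩
        · omega
        · exact h1
      · exact fun hc => ⟨Or.inr hc, mem_deck.1 (hp hc)⟩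
  · intro h hh
    ext c
    simp only [mem_union, mem_block hN, mem_filter, mem_univ, true_and]
    have hc (e : c.1.val = N) : (Fin.ofNat 13 N, c.2) = c :=
      Prod.ext (Fin.ext (by simp [Nat.mod_eq_of_lt hN, e])) rfl
    constructor
    · rintro (⟨h1, h2⟩ | h1)
      · rwa [hc h1] at h2
      · exact h1.1
    · intro h1
      have := mem_deck.1 (mem_powerset.1 hh h1)
      rcases Nat.lt_succ_iff_lt_or_eq.1 this with h2 | h2
      · exact Or.inr ⟨h1, h2⟩
      · exact Or.inl ⟨h2, by rwa [hc h2]⟩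

/-- The sum over the sets of `n` cards of denomination less than `N`. -/
def deckSum (N n : ℕ) (F : Finset Card → ℕ) : ℕ := ∑ h ∈ powersetCard n (deck N), F h

theorem deckSum_succ {N : ℕ} (hN : N < 13) (n : ℕ) (F : Finset Card → ℕ) :
    deckSum (N + 1) n F = deckSum N n F + ([1, 2, 3, 4].map fun m => if m ≤ n then
      ∑ S ∈ powersetCard m univ, deckSum N (n - m) fun h => F (block N S ∪ h) else 0).sum := by
  have h1 (S : Finset (Fin 4)) :
      (∑ h ∈ (deck N).powerset, if (block N S ∪ h).card = n then F (block N S ∪ h) else 0) =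
        if S.card ≤ n then deckSum N (n - S.card) fun h => F (block N S ∪ h) else 0 := by
    rw [sum_congr rfl fun h hh => by
      rw [card_union_of_disjoint (disjoint_block hN (mem_powerset.1 hh)), card_block]]
    split_ifs with hS
    · rw [deckSum, powersetCard_eq_filter, sum_filter]
      refine sum_congr rfl fun h _ => ?_
      split_ifs <;> first | rfl | omega
    · exact sum_eq_zero fun h _ => if_neg (by omega)
  have h2 (m : ℕ) : (∑ S ∈ powersetCard m (univ : Finset (Fin 4)), if S.card ≤ n then
      deckSum N (n - S.card) fun h => F (block N S ∪ h) else 0) = if m ≤ n then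
      ∑ S ∈ powersetCard m univ, deckSum N (n - m) fun h => F (block N S ∪ h) else 0 := by
    rw [sum_congr rfl fun S hS => by rw [(mem_powersetCard.1 hS).2]]
    split_ifs
    · rfl
    · exact sum_const_zero
  rw [deckSum, powersetCard_eq_filter, sum_filter, sum_powerset_deck_succ hN,
    sum_congr rfl fun S _ => h1 S, ← powerset_univ, sum_powerset, sum_congr rfl fun m _ => h2 m]
  -- The term `m = 0`, where denomination `N` is absent, is split off; it gives `deckSum N n F`.
  rw [card_univ, Fintype.card_fin, sum_range_succ']
  simp only [sum_range_succ, range_zero, sum_empty, List.map_cons, List.map_nil, List.sum_cons,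
    List.sum_nil, powersetCard_zero, sum_singleton, zero_le, if_true, block, image_empty,
    empty_union, Nat.sub_zero, zero_add, Nat.reduceAdd, deckSum]
  ring

/-- The sum over the sets of cards such that `κ` lists the numbers of cards of each denomination,
denominations being less than `N`. -/
def patternSum (N : ℕ) (κ : List ℕ) (F : Finset Card → ℕ) : ℕ :=
  ((lanes N κ.length).map fun ρ => suitSum κ fun τ => F (build ρ τ)).sum

theorem patternSum_nil (N : ℕ) (F : Finset Card → ℕ) : patternSum N [] F = F ∅ := by
  simp [patternSum, lanes_zero_right, suitSum, build]

theorem patternSum_zero (m : ℕ) (κ : List ℕ) (F : Finset Card → ℕ) :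
    patternSum 0 (m :: κ) F = 0 := by
  simp [patternSum, lanes]

theorem patternSum_succ (N m : ℕ) (κ : List ℕ) (F : Finset Card → ℕ) :
    patternSum (N + 1) (m :: κ) F =
      (∑ S ∈ powersetCard m univ, patternSum N κ fun h => F (block N S ∪ h)) +
        patternSum N (m :: κ) F := by
  rw [patternSum, List.length_cons, lanes, List.map_append, List.sum_append]
  congr 1
  simp only [patternSum, sum_list_sum, List.map_map]
  rfl

/-- Both sides satisfy the same recursion in `N`: either denomination `N` is absent, or it
contributes the first part of the composition. -/
theorem deckSum_eq {N n f : ℕ} (hN : N ≤ 13) (hf : n ≤ f) (F : Finset Card → ℕ) :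
    deckSum N n F = ((compositions f n).map fun κ => patternSum N κ F).sum := by
  induction N generalizing n f F with
  | zero =>
    have h0 : deck 0 = ∅ := by simp [deck]
    cases n with
    | zero => cases f <;> simp [compositions, patternSum_nil, deckSum]
    | succ n =>
      obtain ⟨f, rfl⟩ := Nat.exists_eq_add_of_le' (Nat.le_of_add_left_le hf)
      rw [deckSum, h0, powersetCard_eq_empty.2 (by simp), sum_empty]
      symm
      refine List.sum_eq_zero fun x hx => ?_
      simp only [compositions, List.mem_map, List.mem_flatMap] at hx
      obtain ⟨κ, ⟨m, -, hκ⟩, rfl⟩ := hx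
      split_ifs at hκ
      · obtain ⟨κ', -, rfl⟩ := List.mem_map.1 hκ
        exact patternSum_zero _ _ _
      · simp at hκ
  | succ N ih =>
    cases n with
    | zero => cases f <;> simp [compositions, patternSum_nil, deckSum]
    | succ n =>
      obtain ⟨f, rfl⟩ := Nat.exists_eq_add_of_le' (Nat.le_of_add_left_le hf)
      rw [deckSum_succ (by omega), ih (by omega) hf]
      simp only [compositions, List.map_flatMap, list_sum_flatMap, ← List.sum_map_add]
      refine congrArg List.sum (List.map_congr_left fun m hm => ?_)
      split_ifs
      · have hm0 : m ≠ 0 := by rintro rfl; simp at hm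
        simp only [List.map_map, Function.comp_def, patternSum_succ, List.sum_map_add,
          ← sum_list_sum]
        rw [add_comm]
        congr 1
        exact sum_congr rfl fun S _ => ih (by omega) (by omega) _
      · rfl

theorem mem_of_mem_compositions {f n : ℕ} {κ : List ℕ} (h : κ ∈ compositions f n) :
    ∀ m ∈ κ, m ∈ [1, 2, 3, 4] := by
  induction f generalizing n κ with
  | zero => cases n <;> simp_all [compositions]
  | succ f ih =>
    cases n with
    | zero => simp_all [compositions]
    | succ n =>
      obtain ⟨m, hm, hκ⟩ := List.mem_flatMap.1 h
      split_ifs at hκ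
      · obtain ⟨κ', h', rfl⟩ := List.mem_map.1 hκ
        exact List.forall_mem_cons.2 ⟨hm, ih h'⟩
      · simp at hκ

/-- The sum of a symmetric function over all initial hands. -/
theorem sum_hands {F : Finset Card → ℕ} (hF : ∀ g h, F (permute g h) = F h) :
    ∑ h ∈ powersetCard 5 univ, F h = ((compositions 5 5).map fun κ =>
      ((lanes 13 κ.length).map fun ρ =>
        ((suitClasses κ 0 0).map fun p => p.1 * F (cardsOf ρ p.2)).sum).sum).sum := by
  have h13 : deck 13 = univ := by
    ext c
    simp [mem_deck]
  rw [← h13]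
  refine (deckSum_eq le_rfl le_rfl F).trans ?_
  refine congrArg List.sum (List.map_congr_left fun κ hκ => ?_)
  refine congrArg List.sum (List.map_congr_left fun ρ hρ => ?_)
  rw [suitSum_eq (mem_of_mem_compositions hκ) (Nat.zero_lt_succ 4), suitClasses_eq, List.map_map]
  · refine congrArg List.sum (List.map_congr_left fun p hp => ?_)
    rw [Function.comp_apply, ← cardsOf_encode []]
    · rfl
    · rw [length_of_mem_suitReps hp, (mem_lanes.1 hρ).1]
  · intro g _ τ
    rw [← permute_build, hF]

end Enumeration

/-! ### Moments of the values of the initial hands -/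

section Totals

open Finset

/-- The bound 1024 on the total multiplicity ensures that the weighted sum of values below `2 ^ 76`
fits into a lane. -/
theorem isCode_of_mem_suitClasses : ∀ κ ∈ compositions 5 5,
    (∀ p ∈ suitClasses κ 0 0, p.2.Nodup ∧ p.2.length = 5 ∧ ∀ q ∈ p.2, q.1 < κ.length ∧ q.2 < 4) ∧
      ((suitClasses κ 0 0).map Prod.fst).sum ≤ 1024 := by
  decide +kernel

theorem maxValue_lt (plus : Bool) {h : Finset Card} (hh : h.card = 5) :
    maxValue (handWeight plus) h < 2 ^ 76 :=
  (Finset.sup_le fun _ hs => value_le (handWeight_le plus) hh (mem_powerset.1 hs)).trans_lt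
    (by norm_num)

/-- Here `post` is a packed operation that applies `φ` in each lane: the identity, division by `2 ^
43`, or division followed by squaring. -/
theorem total_eq (plus : Bool) {post : ℕ → ℕ → ℕ} {φ : ℕ → ℕ}
    (hpost : ∀ (m : ℕ) (L : List (List ℕ)) (f : List ℕ → ℕ), L.length = m →
      (∀ x ∈ L, f x < 2 ^ 76) → post m (pack L f) = pack L fun x => φ (f x))
    (hφ : ∀ x < 2 ^ 76, φ x < 2 ^ 76) :
    total post plus = ∑ h ∈ powersetCard 5 univ, φ (maxValue (handWeight plus) h) := by
  rw [sum_hands fun g h => by rw [maxValue_permute (handWeight_permute plus)], total, lsum_eq]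
  refine congrArg List.sum (List.map_congr_left fun κ hκ => ?_)
  obtain ⟨hp, hb⟩ := isCode_of_mem_suitClasses κ hκ
  have hm : (lanes 13 κ.length).length = binom 13 (len κ) := by
    rw [length_lanes, binom_eq, len_eq]
  have hlt (p) (hpm : p ∈ suitClasses κ 0 0) (ρ) (hρ : ρ ∈ lanes 13 κ.length) :
      maxValue (handWeight plus) (cardsOf ρ p.2) < 2 ^ 76 := by
    obtain ⟨h1, h2, h3⟩ := hp p hpm
    exact maxValue_lt plus ((IsCode.card_cardsOf ⟨h1, h3⟩ hρ).trans h2)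
  have h (p) (hpm : p ∈ suitClasses κ 0 0) :
      p.1 * post (binom 13 (len κ)) (values plus (len κ) p.2) = pack (lanes 13 κ.length) fun ρ =>
        p.1 * φ (maxValue (handWeight plus) (cardsOf ρ p.2)) := by
    obtain ⟨h1, h2, h3⟩ := hp p hpm
    rw [len_eq κ, IsCode.values_eq plus ⟨h1, h3⟩ h2,
      hpost _ _ _ (by rw [length_lanes, binom_eq]) (hlt p hpm), pack_mul]
  rw [lsum_eq]
  refine (congrArg (fun l => laneSum _ (List.sum l)) (List.map_congr_left h)).trans ?_
  rw [pack_list_sum, laneSum_eq hm]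
  intro ρ hρ
  calc ((suitClasses κ 0 0).map fun p =>
        p.1 * φ (maxValue (handWeight plus) (cardsOf ρ p.2))).sum
      ≤ ((suitClasses κ 0 0).map fun p => p.1 * 2 ^ 76).sum :=
        List.sum_le_sum fun p hpm => Nat.mul_le_mul_left _ (hφ _ (hlt p hpm ρ hρ)).le
    _ = ((suitClasses κ 0 0).map Prod.fst).sum * 2 ^ 76 := List.sum_map_mul_right _ _ _
    _ ≤ 1024 * 2 ^ 76 := Nat.mul_le_mul_right _ hb
    _ < 2 ^ 96 := by norm_num

theorem sum_maxValue_weight (plus : Bool) :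
    ∑ h ∈ powersetCard 5 univ, maxValue (handWeight plus) h = total (fun _ a => a) plus :=
  (total_eq plus (φ := id) (fun _ _ _ _ _ => rfl) fun _ h => h).symm

theorem sum_maxValue_div (plus : Bool) :
    ∑ h ∈ powersetCard 5 univ, maxValue (handWeight plus) h / 2 ^ 43 = total high plus :=
  (total_eq plus (fun _ _ _ hm hf => high_eq hm fun x hx => (hf x hx).trans (by norm_num))
    fun _ h => (Nat.div_le_self _ _).trans_lt h).symm

theorem sum_maxValue_div_sq (plus : Bool) :
    ∑ h ∈ powersetCard 5 univ, (maxValue (handWeight plus) h / 2 ^ 43) ^ 2 =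
      total (fun m a => squares m (high m a)) plus := by
  have h (x : ℕ) (hx : x < 2 ^ 76) : x / 2 ^ 43 < 2 ^ 33 := Nat.div_lt_of_lt_mul (by omega)
  refine (total_eq plus (φ := fun x => (x / 2 ^ 43) ^ 2) (fun m L f hm hf => ?_)
    fun x hx => ?_).symm
  · rw [high_eq hm fun x hx => (hf x hx).trans (by norm_num),
      squares_eq hm fun x hx => h _ (hf x hx)]
  · exact (Nat.pow_lt_pow_left (h x hx) two_ne_zero).trans (by norm_num)

theorem value_handWeight_true (h s : Finset Card) : value (handWeight true) h s =
    2 ^ 43 * value payout h s + value (fun f => payout f ^ 2) h s := by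
  simp only [value, containSum, handWeight, weight_true, sum_add_distrib, ← sum_mul]
  ring

theorem value_handWeight_false (h s : Finset Card) :
    value (handWeight false) h s + value (fun f => payout f ^ 2) h s =
      2 ^ 43 * value payout h s := by
  simp only [value, containSum, handWeight, weight_false]
  rw [← mul_add, ← sum_add_distrib, sum_congr rfl fun f _ => Nat.sub_add_cancel
    (show payout f ^ 2 ≤ payout f * 2 ^ 43 by
      have := payout_le f
      rw [sq]
      gcongr
      omega), ← sum_mul]
  ring

/-- `7669695 * 800 ^ 2 < 2 ^ 43`: this makes the weights order holds lexicographically. -/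
theorem value_sq_lt {h s : Finset Card} (hh : h.card = 5) (hs : s ⊆ h) :
    value (fun f => payout f ^ 2) h s < 2 ^ 43 :=
  (value_le (C := 800 ^ 2) (fun f => Nat.pow_le_pow_left (payout_le f) 2) hh hs).trans_lt
    (by norm_num)

theorem value_le_maxValue (w : Finset Card → ℕ) {h s : Finset Card} (hs : s ⊆ h) :
    value w h s ≤ maxValue w h :=
  le_sup (f := value w h) (mem_powerset.2 hs)

theorem exists_value_eq_maxValue (w : Finset Card → ℕ) (h : Finset Card) :
    ∃ s ⊆ h, value w h s = maxValue w h := by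
  obtain ⟨s, hs, hs'⟩ := exists_mem_eq_sup h.powerset ⟨∅, empty_mem_powerset _⟩ (value w h)
  exact ⟨s, mem_powerset.1 hs, hs'.symm⟩

/-- A maximizer `s` of the mean bounds the maximal weight from below. At a maximizer `t` of the
weight, the second moment is too small to make up for a smaller mean. -/
theorem maxValue_handWeight_div {h : Finset Card} (hh : h.card = 5) :
    maxValue (handWeight true) h / 2 ^ 43 = maxValue payout h := by
  obtain ⟨s, hs, hs'⟩ := exists_value_eq_maxValue payout h
  obtain ⟨t, ht, ht'⟩ := exists_value_eq_maxValue (handWeight true) h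
  have h1 := value_le_maxValue (handWeight true) hs
  have h2 := value_le_maxValue payout ht
  have h3 := value_sq_lt hh ht
  rw [value_handWeight_true, hs'] at h1
  rw [value_handWeight_true] at ht'
  omega

theorem total_plus_and : total (fun _ a => a) true = 174534856642157423423339124 ∧
    total high true = 19842315923796 ∧
      total (fun m a => squares m (high m a)) true = 452115441148910245356 := by
  have h := total_plus
  rwa [Prod.mk.injEq, Prod.mk.injEq] at h

theorem sum_maxValue : ∑ h ∈ powersetCard 5 univ, maxValue payout h = 19842315923796 := by
  rw [← sum_congr rfl fun h hh => maxValue_handWeight_div (mem_powersetCard.1 hh).2,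
    sum_maxValue_div, total_plus_and.2.1]

theorem sum_maxValue_sq :
    ∑ h ∈ powersetCard 5 univ, maxValue payout h ^ 2 = 452115441148910245356 := by
  rw [← total_plus_and.2.2, ← sum_maxValue_div_sq]
  refine sum_congr rfl fun h hh => ?_
  rw [maxValue_handWeight_div (mem_powersetCard.1 hh).2]

theorem sum_maxValue_add_sum_value_le {K : ℕ} {w u v : Finset Card → ℕ}
    (hw : ∀ h s, value w h s = K * value u h s + value v h s) {s : Finset Card → Finset Card}
    {t : Finset (Finset Card)} (hs : ∀ h ∈ t, s h ⊆ h ∧ value u h (s h) = maxValue u h) :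
    K * ∑ h ∈ t, maxValue u h + ∑ h ∈ t, value v h (s h) ≤ ∑ h ∈ t, maxValue w h := by
  rw [mul_sum, ← sum_add_distrib]
  refine sum_le_sum fun h hh => ?_
  rw [← (hs h hh).2, ← hw]
  exact value_le_maxValue w (hs h hh).1

theorem sum_maxValue_le_add_sum_value {K : ℕ} {w u v : Finset Card → ℕ}
    (hw : ∀ h s, value w h s + value v h s = K * value u h s) {s : Finset Card → Finset Card}
    {t : Finset (Finset Card)} (hs : ∀ h ∈ t, s h ⊆ h ∧ value u h (s h) = maxValue u h) :
    K * ∑ h ∈ t, maxValue u h ≤ ∑ h ∈ t, maxValue w h + ∑ h ∈ t, value v h (s h) := by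
  rw [mul_sum, ← sum_add_distrib]
  refine sum_le_sum fun h hh => ?_
  rw [← (hs h hh).2, ← hw]
  exact Nat.add_le_add_right (value_le_maxValue w (hs h hh).1) _

/-- The plus weight bounds the sum of second moments from above, the minus weight from below, and
the computed bounds coincide; so no choice among tied holds changes it. -/
theorem sum_value_sq {s : Finset Card → Finset Card}
    (hs : ∀ h ∈ (powersetCard 5 univ : Finset (Finset Card)),
      s h ⊆ h ∧ value payout h (s h) = maxValue payout h) :
    ∑ h ∈ powersetCard 5 univ, value (fun f => payout f ^ 2) h (s h) = 408742359677556 := by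
  have key (a b c v : ℕ) (h1 : 2 ^ 43 * a + v ≤ c) (h2 : 2 ^ 43 * a ≤ b + v)
      (h3 : b = 174534856641339938703984012) (h4 : a = 19842315923796)
      (h5 : c = 174534856642157423423339124) : v = 408742359677556 := by omega
  exact key _ _ _ _ (sum_maxValue_add_sum_value_le value_handWeight_true hs)
    (sum_maxValue_le_add_sum_value value_handWeight_false hs)
    ((sum_maxValue_weight false).trans total_minus) sum_maxValue
    ((sum_maxValue_weight true).trans total_plus_and.1)

end Totals

/-! ### Integrals with respect to the law of the game -/

section Probability

theorem integral_uniformOn {Ω : Type*} [Finite Ω] [MeasurableSpace Ω]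
    [MeasurableSingletonClass Ω] (s : Finset Ω) (f : Ω → ℝ) :
    ∫ x, f x ∂(uniformOn (s : Set Ω)) = (∑ x ∈ s, f x) / s.card := by
  rw [uniformOn, ProbabilityTheory.cond, integral_smul_measure, setIntegral_finset]
  · simp [measureReal_def, Measure.count_apply_finset, div_eq_inv_mul]
  · exact Integrable.of_finite.integrableOn

instance isProbabilityMeasure_dealLaw : IsProbabilityMeasure dealLaw := by
  have : Nonempty Hand := by
    obtain ⟨s, -, hs⟩ := Finset.exists_subset_card_eq (s := (Finset.univ : Finset Card)) (n := 5)
      (by simp)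
    exact ⟨⟨s, hs⟩⟩
  exact isProbabilityMeasure_uniformOn Set.finite_univ Set.univ_nonempty

/-- The possible draws to the cards `s` of the initial hand `h`. -/
def draws (h s : Finset Card) : Finset (Finset Card) := hᶜ.powersetCard (5 - s.card)

theorem drawLaw_eq (h : Hand) (s : Finset Card) :
    drawLaw h s = uniformOn (draws h.1 s : Set (Finset Card)) := by
  rw [drawLaw]
  congr 1
  ext d
  simp [draws, Finset.mem_powersetCard, Finset.subset_compl_iff_disjoint_right]

theorem card_draws (h : Hand) (s : Finset Card) :
    (draws h.1 s).card = Nat.choose 47 (5 - s.card) := by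
  rw [draws, Finset.card_powersetCard, Finset.card_compl, h.2]
  rfl

instance isProbabilityMeasure_drawLaw (h : Hand) (s : Finset Card) :
    IsProbabilityMeasure (drawLaw h s) := by
  rw [drawLaw_eq]
  refine isProbabilityMeasure_uniformOn (Finset.finite_toSet _) ?_
  rw [Finset.coe_nonempty, ← Finset.card_pos, card_draws]
  exact Nat.choose_pos (by omega)

instance isMarkovKernel_drawsKernel (σ : Strategy) (n : ℕ) : IsMarkovKernel (drawsKernel σ n) :=
  ⟨fun h => inferInstanceAs (IsProbabilityMeasure (Measure.pi fun _ => drawLaw h (σ.hold h)))⟩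

instance isProbabilityMeasure_gameLaw (σ : Strategy) (n : ℕ) :
    IsProbabilityMeasure (gameLaw σ n) :=
  inferInstanceAs (IsProbabilityMeasure (dealLaw ⊗ₘ drawsKernel σ n))

theorem integral_dealLaw (f : Hand → ℝ) : ∫ h, f h ∂dealLaw = (∑ h, f h) / 2598960 := by
  have hc : (Finset.univ : Finset Hand).card = 2598960 := by
    rw [Finset.card_univ]
    exact (Fintype.card_finset_len (α := Card) 5).trans (by decide +kernel)
  rw [dealLaw, ← Finset.coe_univ, integral_uniformOn, hc]
  norm_num

theorem sum_hand (F : Finset Card → ℕ) :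
    ∑ h : Hand, F h.1 = ∑ h ∈ Finset.univ.powersetCard 5, F h :=
  (Finset.sum_subtype (p := fun h : Finset Card => h.card = 5) (F := inferInstance) _
    (by simp) F).symm

theorem integral_drawLaw (h : Hand) {s : Finset Card} (hs : s ⊆ h.1) (f : Finset Card → ℕ) :
    ∫ d, (f (s ∪ d) : ℝ) ∂(drawLaw h s) = value f h.1 s / 7669695 := by
  have hsc : s.card ≤ 5 := h.2 ▸ Finset.card_le_card hs
  have key {a b c x : ℝ} (h1 : a * b = c) (h2 : c ≠ 0) : x / b = a * x / c := by
    have ha : a ≠ 0 := fun h => h2 (by rw [← h1, h, zero_mul])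
    rw [← h1, mul_div_mul_left _ _ ha]
  rw [drawLaw_eq, integral_uniformOn, card_draws, value, ← sum_powersetCard_compl f h.2 hs,
    Nat.cast_mul, Nat.cast_sum]
  exact key (by exact_mod_cast congrArg (Nat.cast (R := ℝ)) (scale_mul_choose hsc)) (by norm_num)

theorem integral_gameLaw (σ : Strategy) {n : ℕ} (f : Hand × (Fin n → Finset Card) → ℝ) :
    ∫ ω, f ω ∂(gameLaw σ n) =
      ∫ h, ∫ d, f (h, d) ∂(Measure.pi fun _ : Fin n => drawLaw h (σ.hold h)) ∂dealLaw :=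
  Measure.integral_compProd .of_finite

theorem setIntegral_gameLaw (σ : Strategy) {n : ℕ} (f : Hand × (Fin n → Finset Card) → ℝ)
    (A : Set Hand) :
    ∫ ω in Prod.fst ⁻¹' A, f ω ∂(gameLaw σ n) =
      ∫ h in A, ∫ d, f (h, d) ∂(Measure.pi fun _ : Fin n => drawLaw h (σ.hold h)) ∂dealLaw := by
  rw [← integral_indicator .of_discrete, ← integral_indicator .of_discrete, integral_gameLaw]
  congr 1
  funext h
  by_cases hA : h ∈ A <;> simp [Set.indicator, hA]

/-! ### Moments given the initial hand and the law of total variance -/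

/-- The expected return, given the initial hand. -/
noncomputable def handMean (σ : Strategy) (h : Hand) : ℝ := value payout h.1 (σ.hold h) / 7669695

/-- The second moment of the return, given the initial hand. -/
noncomputable def handSq (σ : Strategy) (h : Hand) : ℝ :=
  value (fun f => payout f ^ 2) h.1 (σ.hold h) / 7669695

theorem integral_playReturn_pi (σ : Strategy) (h : Hand) {n : ℕ} (i : Fin n) :
    ∫ d, playReturn σ i (h, d) ∂(Measure.pi fun _ : Fin n => drawLaw h (σ.hold h)) =
      handMean σ h := by
  have h1 := integral_map (μ := Measure.pi fun _ : Fin n => drawLaw h (σ.hold h))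
    (measurable_pi_apply i).aemeasurable
    (f := fun d => (payout (σ.hold h ∪ d) : ℝ)) (.of_discrete)
  rw [(measurePreserving_eval _ i).map_eq, integral_drawLaw h (σ.hold_subset h) payout] at h1
  exact h1.symm

theorem integral_averageReturn_pi (σ : Strategy) (h : Hand) {n : ℕ} (hn : 1 ≤ n) :
    ∫ d, averageReturn σ n (h, d) ∂(Measure.pi fun _ : Fin n => drawLaw h (σ.hold h)) =
      handMean σ h := by
  have hn' : (n : ℝ) ≠ 0 := by positivity
  simp only [averageReturn, integral_div]
  rw [integral_finsetSum _ fun _ _ => .of_finite]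
  simp only [integral_playReturn_pi, Finset.sum_const, Finset.card_univ, Fintype.card_fin,
    nsmul_eq_mul]
  exact mul_div_cancel_left₀ _ hn'

theorem variance_payout (σ : Strategy) (h : Hand) :
    Var[fun d => (payout (σ.hold h ∪ d) : ℝ); drawLaw h (σ.hold h)] =
      handSq σ h - handMean σ h ^ 2 := by
  have h1 := integral_drawLaw h (σ.hold_subset h) fun f => payout f ^ 2
  simp only [Nat.cast_pow] at h1
  rw [variance_eq_sub .of_discrete, integral_drawLaw h (σ.hold_subset h) payout]
  exact congrArg (· - _) h1

/-- Given the hand, the variance of the average of `n` independent returns is that of one return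
divided by `n`. -/
theorem integral_averageReturn_sq_pi (σ : Strategy) (h : Hand) {n : ℕ} (hn : 1 ≤ n) :
    ∫ d, averageReturn σ n (h, d) ^ 2 ∂(Measure.pi fun _ : Fin n => drawLaw h (σ.hold h)) =
      handMean σ h ^ 2 + (handSq σ h - handMean σ h ^ 2) / n := by
  have hn' : (n : ℝ) ≠ 0 := by positivity
  have h1 := variance_sum_pi (μ := fun _ : Fin n => drawLaw h (σ.hold h))
    (X := fun _ d => (payout (σ.hold h ∪ d) : ℝ)) fun _ => .of_discrete
  have h2 : (fun d => averageReturn σ n (h, d)) =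
      fun d => (n : ℝ)⁻¹ * (∑ i : Fin n, fun d : Fin n → Finset Card =>
        (payout (σ.hold h ∪ d i) : ℝ)) d := by
    funext d
    simp [averageReturn, playReturn, div_eq_inv_mul]
  have h3 : Var[fun d => averageReturn σ n (h, d);
      Measure.pi fun _ : Fin n => drawLaw h (σ.hold h)] =
        (handSq σ h - handMean σ h ^ 2) / n := by
    rw [h2, variance_const_mul, h1]
    simp only [variance_payout, Finset.sum_const, Finset.card_univ, Fintype.card_fin, nsmul_eq_mul]
    field_simp
  rw [variance_eq_sub .of_discrete, integral_averageReturn_pi σ h hn] at h3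
  rw [← h3]
  simp

theorem integral_averageReturn (σ : Strategy) {n : ℕ} (hn : 1 ≤ n) :
    ∫ ω, averageReturn σ n ω ∂(gameLaw σ n) = ∫ h, handMean σ h ∂dealLaw := by
  simp only [integral_gameLaw, integral_averageReturn_pi σ _ hn]

theorem variance_averageReturn (σ : Strategy) {n : ℕ} (hn : 1 ≤ n) :
    Var[averageReturn σ n; gameLaw σ n] = Var[handMean σ; dealLaw] +
      (∫ h, handSq σ h ∂dealLaw - ∫ h, handMean σ h ^ 2 ∂dealLaw) / n := by
  rw [variance_eq_sub .of_discrete, variance_eq_sub .of_discrete, integral_averageReturn σ hn]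
  simp only [Pi.pow_apply, integral_gameLaw, integral_averageReturn_sq_pi σ _ hn]
  rw [integral_add .of_finite .of_finite, integral_div, integral_sub .of_finite .of_finite]
  ring

theorem averageReturn_one (σ : Strategy) : averageReturn σ 1 = R₁ σ := by
  funext ω
  simp [averageReturn, R₁]

theorem meanReturn_eq (σ : Strategy) : meanReturn σ = ∫ h, handMean σ h ∂dealLaw := by
  rw [meanReturn, ← averageReturn_one, integral_averageReturn σ le_rfl]

theorem varReturn_eq (σ : Strategy) : varReturn σ = Var[handMean σ; dealLaw] +
    (∫ h, handSq σ h ∂dealLaw - ∫ h, handMean σ h ^ 2 ∂dealLaw) := by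
  rw [varReturn, ← averageReturn_one, variance_averageReturn σ le_rfl, Nat.cast_one, div_one]

/-! ### The decomposition of the variance -/

theorem dealSigma_le : dealSigma ≤ (inferInstance : MeasurableSpace Single) :=
  fun _ _ => .of_discrete

/-- The conditional mean given the hand is constant on classes by hypothesis, hence measurable with
respect to `dealSigma`, and it has the right integrals over all events determined by the hand. -/
theorem condExp_eq {σ : Strategy} (hσ : ∀ h h', HandEquiv h h' → handMean σ h = handMean σ h') :
    (fun ω => handMean σ ω.1) =ᵐ[gameLaw σ 1] (gameLaw σ 1)[R₁ σ | dealSigma] := by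
  refine ae_eq_condExp_of_forall_setIntegral_eq dealSigma_le .of_finite
    (fun s _ _ => Integrable.of_finite.integrableOn) ?_ ?_
  · rintro s ⟨T, -, rfl⟩ -
    have hs : (fun ω : Single => handClass ω.1) ⁻¹' T = Prod.fst ⁻¹' (handClass ⁻¹' T) := rfl
    rw [hs, setIntegral_gameLaw, setIntegral_gameLaw, ← averageReturn_one]
    simp only [integral_averageReturn_pi σ _ le_rfl, integral_const, probReal_univ, one_smul]
  · have hf : (handMean σ).FactorsThrough handClass := fun h h' hh => by
      refine hσ h h' ?_
      have : h' ∈ handClass h' := ⟨1, by simp⟩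
      rwa [← hh] at this
    -- The default value `0` is irrelevant: it is taken only at sets that are not classes of hands.
    have : (fun ω : Single => handMean σ ω.1) =
        Function.extend handClass (handMean σ) 0 ∘ fun ω => handClass ω.1 := by
      funext ω
      exact (hf.extend_apply 0 ω.1).symm
    rw [this]
    refine (Measurable.stronglyMeasurable ?_).aestronglyMeasurable
    exact (measurable_from_top (f := Function.extend handClass (handMean σ) 0)).comp
      (comap_measurable _)

theorem vDeal_eq {σ : Strategy} (hσ : ∀ h h', HandEquiv h h' → handMean σ h = handMean σ h') :
    vDeal σ = Var[handMean σ; dealLaw] := by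
  rw [vDeal, ← variance_congr (condExp_eq hσ), variance_eq_sub .of_discrete,
    variance_eq_sub .of_discrete]
  simp only [Pi.pow_apply, integral_gameLaw, integral_const, probReal_univ, one_smul]

theorem vDraw_add_vDeal (σ : Strategy) : vDraw σ + vDeal σ = varReturn σ :=
  integral_condVar_add_variance_condExp dealSigma_le .of_discrete

/-! ### Optimal strategies -/

theorem meanReturn_eq_sum (σ : Strategy) : meanReturn σ =
    ((∑ h : Hand, value payout h.1 (σ.hold h) : ℕ) : ℝ) / (7669695 * 2598960) := by
  rw [meanReturn_eq, integral_dealLaw, Nat.cast_sum, ← div_div]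
  congr 1
  exact (Finset.sum_div _ _ _).symm

theorem meanReturn_le_iff (σ τ : Strategy) : meanReturn τ ≤ meanReturn σ ↔
    ∑ h : Hand, value payout h.1 (τ.hold h) ≤ ∑ h : Hand, value payout h.1 (σ.hold h) := by
  rw [meanReturn_eq_sum, meanReturn_eq_sum, div_le_div_iff_of_pos_right (by norm_num),
    Nat.cast_le]

theorem exists_maximal_strategy :
    ∃ σ : Strategy, ∀ h : Hand, value payout h.1 (σ.hold h) = maxValue payout h.1 := by
  choose s hs hs' using exists_value_eq_maxValue payout
  exact ⟨⟨fun h => s h.1, fun h => hs h.1⟩, fun h => hs' h.1⟩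

/-- Holds may be chosen independently for each hand, and all hands are equally likely; a sum of
terms bounded by their maxima reaches the sum of the maxima only if every term does. -/
theorem isOptimal_iff (σ : Strategy) :
    IsOptimal σ ↔ ∀ h : Hand, value payout h.1 (σ.hold h) = maxValue payout h.1 := by
  constructor
  · intro hσ h
    obtain ⟨τ, hτ⟩ := exists_maximal_strategy
    have h1 := (meanReturn_le_iff σ τ).1 (hσ τ)
    rw [Finset.sum_congr rfl fun h _ => hτ h] at h1
    have h2 (h : Hand) (_ : h ∈ Finset.univ) := value_le_maxValue payout (σ.hold_subset h)
    exact (Finset.sum_eq_sum_iff_of_le h2).1 (le_antisymm (Finset.sum_le_sum h2) h1) h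
      (Finset.mem_univ h)
  · intro hσ τ
    refine (meanReturn_le_iff σ τ).2 (Finset.sum_le_sum fun h _ => ?_)
    rw [hσ h]
    exact value_le_maxValue payout (τ.hold_subset h)

theorem exists_isOptimal : ∃ σ, IsOptimal σ :=
  exists_maximal_strategy.imp fun σ => (isOptimal_iff σ).2

variable {σ : Strategy}

theorem IsOptimal.handMean_eq (hσ : IsOptimal σ) (h : Hand) :
    handMean σ h = maxValue payout h.1 / 7669695 := by
  rw [handMean, (isOptimal_iff σ).1 hσ h]

/-- The strategy itself need not respect suit permutations, since ties may be broken differently in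
equivalent hands, but its conditional mean is the maximum, which does. -/
theorem IsOptimal.handMean_congr (hσ : IsOptimal σ) (h h' : Hand) (hh : HandEquiv h h') :
    handMean σ h = handMean σ h' := by
  obtain ⟨g, hg⟩ := hh
  rw [hσ.handMean_eq, hσ.handMean_eq, hg]
  exact congrArg (fun x : ℕ => (x : ℝ) / 7669695) (maxValue_permute payout_permute g h.1).symm

theorem IsOptimal.integral_handMean (hσ : IsOptimal σ) :
    ∫ h, handMean σ h ∂dealLaw = 1653526326983 / 1661102543100 := by
  have h1 := (sum_hand (maxValue payout)).trans sum_maxValue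
  simp only [hσ.handMean_eq, integral_dealLaw]
  rw [← Finset.sum_div, ← Nat.cast_sum, h1]
  norm_num

theorem IsOptimal.integral_handMean_sq (hσ : IsOptimal σ) :
    ∫ h, handMean σ h ^ 2 ∂dealLaw = 452115441148910245356 / (7669695 ^ 2 * 2598960) := by
  have h1 := (sum_hand fun h => maxValue payout h ^ 2).trans sum_maxValue_sq
  simp only [hσ.handMean_eq, integral_dealLaw, div_pow, ← Nat.cast_pow]
  rw [← Finset.sum_div, ← Nat.cast_sum, h1]
  norm_num

theorem IsOptimal.integral_handSq (hσ : IsOptimal σ) :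
    ∫ h, handSq σ h ∂dealLaw = 408742359677556 / (7669695 * 2598960) := by
  -- The strategy is extended to all sets of cards; the value `∅` is never used, as only five-card
  -- sets enter the sum.
  let s (h : Finset Card) : Finset Card := if hc : h.card = 5 then σ.hold ⟨h, hc⟩ else ∅
  have hs (h : Hand) : s h.1 = σ.hold h := dif_pos h.2
  have h0 (h : Finset Card) (hh : h ∈ (Finset.univ.powersetCard 5 : Finset (Finset Card))) :
      s h ⊆ h ∧ value payout h (s h) = maxValue payout h := by
    have hc := (Finset.mem_powersetCard.1 hh).2
    have := hs ⟨h, hc⟩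
    rw [this]
    exact ⟨σ.hold_subset ⟨h, hc⟩, (isOptimal_iff σ).1 hσ ⟨h, hc⟩⟩
  have h1 := (sum_hand fun h => value (fun f => payout f ^ 2) h (s h)).trans (sum_value_sq h0)
  simp only [hs] at h1
  simp only [handSq, integral_dealLaw]
  rw [← Finset.sum_div, ← Nat.cast_sum, h1]
  norm_num

theorem IsOptimal.variance_handMean (hσ : IsOptimal σ) : Var[handMean σ; dealLaw] =
    602864541441854523450139 / 306584628743698595290000 := by
  rw [variance_eq_sub .of_discrete]
  simp only [Pi.pow_apply]
  rw [hσ.integral_handMean, hσ.integral_handMean_sq]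
  norm_num

theorem IsOptimal.meanReturn_eq (hσ : IsOptimal σ) :
    meanReturn σ = 1653526326983 / 1661102543100 := by
  rw [VideoPoker.meanReturn_eq, hσ.integral_handMean]

theorem IsOptimal.vDeal_eq (hσ : IsOptimal σ) :
    vDeal σ = 602864541441854523450139 / 306584628743698595290000 := by
  rw [VideoPoker.vDeal_eq hσ.handMean_congr, hσ.variance_handMean]

theorem IsOptimal.integral_handSq_sub (hσ : IsOptimal σ) :
    ∫ h, handSq σ h ∂dealLaw - ∫ h, handMean σ h ^ 2 ∂dealLaw =
      55891953982463387918 / 3185037467325338625 := by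
  rw [hσ.integral_handSq, hσ.integral_handMean_sq]
  norm_num

theorem IsOptimal.varReturn_eq (hσ : IsOptimal σ) :
    varReturn σ = 53846098447064372932173011 / 2759261658693287357610000 := by
  rw [VideoPoker.varReturn_eq, hσ.integral_handSq_sub, hσ.variance_handMean]
  norm_num

theorem IsOptimal.vDraw_eq (hσ : IsOptimal σ) :
    vDraw σ = 55891953982463387918 / 3185037467325338625 := by
  rw [eq_sub_of_add_eq (vDraw_add_vDeal σ), hσ.varReturn_eq, hσ.vDeal_eq]
  norm_num

theorem IsOptimal.variance_averageReturn (hσ : IsOptimal σ) {n : ℕ} (hn : 1 ≤ n) :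
    Var[averageReturn σ n; gameLaw σ n] =
      602864541441854523450139 / 306584628743698595290000 +
        55891953982463387918 / 3185037467325338625 / n := by
  rw [VideoPoker.variance_averageReturn σ hn, hσ.variance_handMean, hσ.integral_handSq_sub]

theorem IsOptimal.mean_averageReturn (hσ : IsOptimal σ) {n : ℕ} (hn : 1 ≤ n) :
    ∫ ω, averageReturn σ n ω ∂(gameLaw σ n) = 1653526326983 / 1661102543100 := by
  rw [integral_averageReturn σ hn, hσ.integral_handMean]

/-! ### Rounding to six decimal places -/

theorem roundsTo_iff {x a : ℝ} : RoundsTo x a ↔ a - 5 / 10 ^ 7 < x ∧ x < a + 5 / 10 ^ 7 := by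
  rw [RoundsTo, abs_lt]
  constructor <;> rintro ⟨h1, h2⟩ <;> constructor <;> linarith

theorem roundsTo_sqrt {x a : ℝ} (ha : 5 / 10 ^ 7 ≤ a) (h1 : (a - 5 / 10 ^ 7) ^ 2 < x)
    (h2 : x < (a + 5 / 10 ^ 7) ^ 2) : RoundsTo (Real.sqrt x) a := by
  rw [roundsTo_iff]
  exact ⟨Real.lt_sqrt_of_sq_lt h1, (Real.sqrt_lt' (by linarith)).2 h2⟩

end Probability

end VideoPoker

theorem mainTheorem8 :
    (∃ σ, VideoPoker.IsOptimal σ) ∧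
    ∀ σ : VideoPoker.Strategy, VideoPoker.IsOptimal σ →
      -- exact values for the single-play game
      VideoPoker.meanReturn σ = 1653526326983 / 1661102543100 ∧
      VideoPoker.varReturn σ = 53846098447064372932173011 / 2759261658693287357610000 ∧
      VideoPoker.vDeal σ = 602864541441854523450139 / 306584628743698595290000 ∧
      VideoPoker.vDraw σ = 55891953982463387918 / 3185037467325338625 ∧
      VideoPoker.varReturn σ = VideoPoker.vDeal σ + VideoPoker.vDraw σ ∧
      -- decimal values
      VideoPoker.RoundsTo (VideoPoker.meanReturn σ) 0.995439 ∧
      VideoPoker.RoundsTo (VideoPoker.varReturn σ) 19.514676 ∧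
      VideoPoker.RoundsTo (VideoPoker.vDeal σ) 1.966389 ∧
      VideoPoker.RoundsTo (VideoPoker.vDraw σ) 17.548288 ∧
      -- mean and variance of the return per unit bet of the `n`-play game
      (∀ n : ℕ, 1 ≤ n →
        ∫ ω, VideoPoker.averageReturn σ n ω ∂(VideoPoker.gameLaw σ n) =
          VideoPoker.meanReturn σ ∧
        ProbabilityTheory.variance (VideoPoker.averageReturn σ n) (VideoPoker.gameLaw σ n) =
          VideoPoker.vDeal σ + VideoPoker.vDraw σ / n) ∧
      -- the table: `n`, mean, variance, standard deviation
      (∀ row ∈ ([(1, 0.995439, 19.514676, 4.417542),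
                 (3, 0.995439, 7.815818, 2.795678),
                 (5, 0.995439, 5.476046, 2.340095),
                 (10, 0.995439, 3.721217, 1.929046),
                 (25, 0.995439, 2.668320, 1.633499),
                 (50, 0.995439, 2.317354, 1.522286),
                 (100, 0.995439, 2.141872, 1.463513)] : List (ℕ × ℝ × ℝ × ℝ)),
        VideoPoker.RoundsTo
          (∫ ω, VideoPoker.averageReturn σ row.1 ω ∂(VideoPoker.gameLaw σ row.1)) row.2.1 ∧
        VideoPoker.RoundsTo
          (ProbabilityTheory.variance (VideoPoker.averageReturn σ row.1)
            (VideoPoker.gameLaw σ row.1)) row.2.2.1 ∧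
        VideoPoker.RoundsTo
          (Real.sqrt (ProbabilityTheory.variance (VideoPoker.averageReturn σ row.1)
            (VideoPoker.gameLaw σ row.1))) row.2.2.2) := by
  refine ⟨VideoPoker.exists_isOptimal, fun σ hσ => ⟨hσ.meanReturn_eq, hσ.varReturn_eq, hσ.vDeal_eq,
    hσ.vDraw_eq, ?_, ?_, ?_, ?_, ?_, ?_, ?_⟩⟩
  · rw [← VideoPoker.vDraw_add_vDeal, add_comm]
  · rw [hσ.meanReturn_eq, VideoPoker.roundsTo_iff]
    norm_num
  · rw [hσ.varReturn_eq, VideoPoker.roundsTo_iff]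
    norm_num
  · rw [hσ.vDeal_eq, VideoPoker.roundsTo_iff]
    norm_num
  · rw [hσ.vDraw_eq, VideoPoker.roundsTo_iff]
    norm_num
  · intro n hn
    rw [hσ.mean_averageReturn hn, hσ.variance_averageReturn hn, hσ.meanReturn_eq, hσ.vDeal_eq,
      hσ.vDraw_eq]
    exact ⟨rfl, rfl⟩
  -- Each row reduces to rational inequalities; the standard deviation is compared through squares,
  -- so no square root is evaluated.
  · have key {n : ℕ} (hn : 1 ≤ n) {v d : ℝ} (hd : 5 / 10 ^ 7 ≤ d)
        (h1 : v - 5 / 10 ^ 7 < 602864541441854523450139 / 306584628743698595290000 +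
          55891953982463387918 / 3185037467325338625 / n)
        (h2 : 602864541441854523450139 / 306584628743698595290000 +
          55891953982463387918 / 3185037467325338625 / n < v + 5 / 10 ^ 7)
        (h3 : (d - 5 / 10 ^ 7) ^ 2 < 602864541441854523450139 / 306584628743698595290000 +
          55891953982463387918 / 3185037467325338625 / n)
        (h4 : 602864541441854523450139 / 306584628743698595290000 +
          55891953982463387918 / 3185037467325338625 / n < (d + 5 / 10 ^ 7) ^ 2) :
        VideoPoker.RoundsTo
          (∫ ω, VideoPoker.averageReturn σ n ω ∂(VideoPoker.gameLaw σ n)) 0.995439 ∧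
        VideoPoker.RoundsTo (ProbabilityTheory.variance (VideoPoker.averageReturn σ n)
          (VideoPoker.gameLaw σ n)) v ∧
        VideoPoker.RoundsTo (Real.sqrt (ProbabilityTheory.variance
          (VideoPoker.averageReturn σ n) (VideoPoker.gameLaw σ n))) d := by
      rw [hσ.mean_averageReturn hn, hσ.variance_averageReturn hn]
      refine ⟨?_, VideoPoker.roundsTo_iff.2 ⟨h1, h2⟩, VideoPoker.roundsTo_sqrt hd h3 h4⟩
      rw [VideoPoker.roundsTo_iff]
      norm_num
    simp only [List.forall_mem_cons, List.not_mem_nil, false_imp_iff, implies_true, and_true]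
    refine ⟨?_, ?_, ?_, ?_, ?_, ?_, ?_⟩ <;> refine key ?_ ?_ ?_ ?_ ?_ ?_ <;> norm_num
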